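/- **Conventions.** Let $I=(0,1]$ and let $\rho=(\rho_\varepsilon)_{\varepsilon\in I}$ be a gauge, i.e. $\rho_\varepsilon\in(0,1]$ and $\rho_\varepsilon\to0$ as $\varepsilon\to0^+$. "$\forall^0\varepsilon$" means "for all sufficiently small $\varepsilon$". For $\mathbb K\in\{\mathbb R,\mathbb C\}$, a net $(x_\varepsilon)\in\mathbb K^I$ is moderate if $\exists N\in\mathbb N\ \forall^0\varepsilon:|x_\varepsilon|\le\rho_\varepsilon^{-N}$, and negligible if $\forall q\in\mathbb N\ \forall^0\varepsilon:|x_\varepsilon|\le\rho_\varepsilon^{q}$. Let ${}^\rho\widetilde{\mathbb K}$ be the ring of moderate nets modulo negligible nets (the Robinson–Colombeau numbers), $[x_\varepsilon]$ the class of $(x_\varepsilon)$, $\mathrm d\rho=[\rho_\varepsilon]$, and $|[x_\varepsilon]|=[|x_\varepsilon|]$. In ${}^\rho\widetilde{\mathbb R}$, $x\le y$ means $x_\varepsilon\le y_\varepsilon$ $\forall^0\varepsilon$ for some representatives, and $x<y$ means $x\le y$ and $y-x$ is invertible. Put $B_r(c)=\{z\in{}^\rho\widetilde{\mathbb C}:|z-c|<r\}$;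 $U\subseteq{}^\rho\widetilde{\mathbb C}$ is sharply open if every $c\in U$ has a ball $B_r(c)\subseteq U$ with $r\in{}^\rho\widetilde{\mathbb R}$, $r>0$. *Generalized holomorphic functions (GHF).* $f:U\to{}^\rho\widetilde{\mathbb C}$ is a GHF on a sharply open set $U$ if (1) it is a basic function: there is a net of maps $f_\varepsilon$ such that $(f_\varepsilon(z_\varepsilon))$ is moderate and $f([z_\varepsilon])=[f_\varepsilon(z_\varepsilon)]$ for all representatives of all points of $U$; and (2) it has a complex derivative at every $z_0\in U$: there is $m\in{}^\rho\widetilde{\mathbb C}$ with $f(z)=f(z_0)+m(z-z_0)+o(z-z_0)$, that is, for all $q\in\mathbb N$ there is $\delta>0$ in ${}^\rho\widetilde{\mathbb R}$ such that $|f(z)-f(z_0)-m(z-z_0)|\le\mathrm d\rho^{q}\,|z-z_0|$ for all $z\in U\cap B_\delta(z_0)$. (In particular, every function on $U$ that is defined in this way by a net of holomorphic functions, with moderate values and derivatives at all representatives of all points of $U$, is a GHF.) *Hyperseries.* ${}^\rho\widetilde{\mathbb N}\subseteq{}^\rho\widetilde{\mathbb R}$ is the set of the $[n_\varepsilon]$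 with $n_\varepsilon\in\mathbb N$ for all $\varepsilon$; fix for every $N\in{}^\rho\widetilde{\mathbb N}$ such a representative $(N_\varepsilon)$. A net $(b_{n\varepsilon})\in\mathbb C^{\mathbb N\times I}$ is moderate over hypersums if $\bigl(\sum_{n=0}^{N_\varepsilon}b_{n\varepsilon}\bigr)_\varepsilon$ is moderate for all $N\in{}^\rho\widetilde{\mathbb N}$; its hyperseries has the sum $s$ if $\forall q\in\mathbb N\ \exists M\in{}^\rho\widetilde{\mathbb N}\ \forall N\in{}^\rho\widetilde{\mathbb N}:\ N\ge M\Rightarrow\bigl|\bigl[\sum_{n=0}^{N_\varepsilon}b_{n\varepsilon}\bigr]-s\bigr|<\mathrm d\rho^{q}$. *Hyper-power series.* Coefficients $(a_n)_{\rm c}\in{}^\rho\widetilde{\mathbb C}_{\rm c}$ are nets $(a_{n\varepsilon})\in\mathbb C^{\mathbb N\times I}$ with $\exists Q,R\in\mathbb N\ \forall^0\varepsilon\ \forall n\in\mathbb N:|a_{n\varepsilon}|\le\rho_\varepsilon^{-nQ-R}$, modulo the relation $\forall q,r\in\mathbb N\ \forall^0\varepsilon\ \forall n\in\mathbb N:|a_{n\varepsilon}-\bar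 a_{n\varepsilon}|\le\rho_\varepsilon^{nq+r}$. The set of convergence $\mathrm{conv}((a_n)_{\rm c},c)$ is the set of all $z\in{}^\rho\widetilde{\mathbb C}$ such that, for some representatives $(a_{n\varepsilon})$, $(z_\varepsilon)$, $(c_\varepsilon)$ of $(a_n)_{\rm c}$, $z$, $c$: 1. $|z-c|$ is smaller than the radius of convergence: with $r_\varepsilon=\bigl(\limsup_{n\to\infty}|a_{n\varepsilon}|^{1/n}\bigr)^{-1}\in[0,+\infty]$, $\exists m\in\mathbb N\ \forall^0\varepsilon:|z_\varepsilon-c_\varepsilon|+\rho_\varepsilon^{m}\le r_\varepsilon$; 2. $(a_{n\varepsilon}(z_\varepsilon-c_\varepsilon)^n)$ is moderate over hypersums; 3. the net $\sum_{n=0}^{+\infty}a_{n\varepsilon}(z_\varepsilon-c_\varepsilon)^n$ is moderate, and its class is the sum of the hyperseries of the net in 2; 4. for every representative $(\hat z_\varepsilon)$ of $z$, the net of the derivatives at $\hat z_\varepsilon$ of $\zeta\mapsto\sum_{n=0}^{+\infty}a_{n\varepsilon}(\zeta-c_\varepsilon)^n$ is moderate. **Theorem (Goursat).** Let $U\subseteq{}^\rho\widetilde{\mathbb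 C}$ be a sharply open set (for instance, a simply connected one; simple connectedness is not needed) and let $f:U\to{}^\rho\widetilde{\mathbb C}$ be a generalized holomorphic function. Then $f$ is a generalized complex analytic function on $U$: for every $c\in U$ there are $s\in{}^\rho\widetilde{\mathbb R}$, $s>0$, and coefficients $(a_n)_{\rm c}\in{}^\rho\widetilde{\mathbb C}_{\rm c}$ such that (i) $B_s(c)\subseteq U\cap\mathrm{conv}((a_n)_{\rm c},c)$, and (ii) $f(z)=\sum_{n\in{}^\rho\widetilde{\mathbb N}}a_n(z-c)^n$ for all $z\in B_s(c)$; that is, for all representatives $(a_{n\varepsilon})$, $(z_\varepsilon)$, $(c_\varepsilon)$ of $(a_n)_{\rm c}$, $z$, $c$, the net $(a_{n\varepsilon}(z_\varepsilon-c_\varepsilon)^n)$ is moderate over hypersums and its hyperseries has the sum $f(z)$. -/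

import Mathlib

open Filter Topology

noncomputable section

namespace RobinsonColombeau

/-- The index set `I = (0,1]`. The filter `atBot` on `I` is the filter of the sets that contain
some `(0, ε₀]`, so `∀ᶠ ε in atBot, P ε` reads "`P ε` for all sufficiently small `ε`". -/
abbrev I : Type := Set.Ioc (0 : ℝ) 1

/-- A gauge: a net `ρ : I → (0,1]` with `ρ_ε → 0` as `ε → 0⁺`. -/
structure Gauge where
  /-- the underlying net -/
  net : I → ℝ
  pos : ∀ ε, 0 < net ε
  le_one : ∀ ε, net ε ≤ 1
  tendsto_zero : Tendsto net atBot (𝓝 0)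

instance : CoeFun Gauge (fun _ => I → ℝ) := ⟨Gauge.net⟩

theorem Gauge.eventually_two_mul_le (ρ : Gauge) : ∀ᶠ ε in atBot, 2 * ρ ε ≤ 1 := by
  have h := ρ.tendsto_zero.eventually (gt_mem_nhds (show (0 : ℝ) < 1 / 2 by norm_num))
  filter_upwards [h] with ε hε
  linarith

theorem Gauge.eventually_two_mul_pow (ρ : Gauge) (q : ℕ) :
    ∀ᶠ ε in atBot, ρ ε ^ (q + 1) + ρ ε ^ (q + 1) ≤ ρ ε ^ q := by
  filter_upwards [ρ.eventually_two_mul_le] with ε hε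
  have := mul_le_mul_of_nonneg_left hε (pow_nonneg (ρ.pos ε).le q)
  rw [pow_succ]
  linarith

theorem Gauge.one_le_inv (ρ : Gauge) (ε : I) : 1 ≤ (ρ ε)⁻¹ :=
  (one_le_inv₀ (ρ.pos ε)).2 (ρ.le_one ε)

/-! ### The rings of Robinson-Colombeau numbers -/

section Ring

variable (ρ : Gauge) {𝕜 : Type} [NormedField 𝕜]

/-- `ρ`-moderate nets: `|x_ε| ≤ ρ_ε^{-N}` for some `N` and all small `ε`. -/
def IsModerate (x : I → 𝕜) : Prop :=
  ∃ N : ℕ, ∀ᶠ ε in atBot, ‖x ε‖ ≤ (ρ ε)⁻¹ ^ N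

/-- `ρ`-negligible nets: `|x_ε| ≤ ρ_ε^q` for every `q` and all small `ε`. -/
def IsNegligible (x : I → 𝕜) : Prop :=
  ∀ q : ℕ, ∀ᶠ ε in atBot, ‖x ε‖ ≤ ρ ε ^ q

variable {ρ}

theorem IsModerate.add {x y : I → 𝕜} (hx : IsModerate ρ x) (hy : IsModerate ρ y) :
    IsModerate ρ (x + y) := by
  obtain ⟨N, hN⟩ := hx
  obtain ⟨M, hM⟩ := hy
  refine ⟨max N M + 1, ?_⟩
  filter_upwards [hN, hM, ρ.eventually_two_mul_le] with ε h1 h2 h3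
  have h1' := h1.trans (pow_le_pow_right₀ (ρ.one_le_inv ε) (le_max_left N M))
  have h2' := h2.trans (pow_le_pow_right₀ (ρ.one_le_inv ε) (le_max_right N M))
  have h4 : 2 ≤ (ρ ε)⁻¹ := by
    rw [inv_eq_one_div]
    exact (le_div_iff₀ (ρ.pos ε)).2 h3
  calc ‖(x + y) ε‖ ≤ ‖x ε‖ + ‖y ε‖ := norm_add_le _ _
    _ ≤ (ρ ε)⁻¹ ^ (max N M) * 2 := by linarith
    _ ≤ (ρ ε)⁻¹ ^ (max N M) * (ρ ε)⁻¹ :=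
        mul_le_mul_of_nonneg_left h4 (pow_nonneg (inv_nonneg.2 (ρ.pos ε).le) _)
    _ = (ρ ε)⁻¹ ^ (max N M + 1) := (pow_succ _ _).symm

theorem IsModerate.mul {x y : I → 𝕜} (hx : IsModerate ρ x) (hy : IsModerate ρ y) :
    IsModerate ρ (x * y) := by
  obtain ⟨N, hN⟩ := hx
  obtain ⟨M, hM⟩ := hy
  refine ⟨N + M, ?_⟩
  filter_upwards [hN, hM] with ε h1 h2
  rw [Pi.mul_apply, norm_mul, pow_add]
  exact mul_le_mul h1 h2 (norm_nonneg _) (pow_nonneg (inv_nonneg.2 (ρ.pos ε).le) _)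

theorem IsNegligible.add {x y : I → 𝕜} (hx : IsNegligible ρ x) (hy : IsNegligible ρ y) :
    IsNegligible ρ (x + y) := by
  intro q
  filter_upwards [hx (q + 1), hy (q + 1), ρ.eventually_two_mul_pow q] with ε h1 h2 h3
  exact (norm_add_le _ _).trans ((add_le_add h1 h2).trans h3)

theorem IsNegligible.neg {x : I → 𝕜} (hx : IsNegligible ρ x) : IsNegligible ρ (-x) := by
  intro q
  filter_upwards [hx q] with ε h1
  rwa [Pi.neg_apply, norm_neg]

theorem IsModerate.mul_negligible {x y : I → 𝕜} (hx : IsModerate ρ x)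
    (hy : IsNegligible ρ y) : IsNegligible ρ (x * y) := by
  obtain ⟨N, hN⟩ := hx
  intro q
  filter_upwards [hN, hy (q + N)] with ε h1 h2
  have h3 := ρ.pos ε
  calc ‖(x * y) ε‖ = ‖x ε‖ * ‖y ε‖ := by rw [Pi.mul_apply, norm_mul]
    _ ≤ (ρ ε)⁻¹ ^ N * ρ ε ^ (q + N) :=
        mul_le_mul h1 h2 (norm_nonneg _) (pow_nonneg (inv_nonneg.2 h3.le) _)
    _ = ρ ε ^ q := by
        rw [pow_add, inv_pow]
        field_simp

variable (ρ 𝕜)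

/-- The ring of `ρ`-moderate nets. -/
def moderateRing : Subring (I → 𝕜) where
  carrier := {x | IsModerate ρ x}
  mul_mem' := IsModerate.mul
  one_mem' := ⟨0, Eventually.of_forall fun ε => by simp⟩
  add_mem' := IsModerate.add
  zero_mem' := ⟨0, Eventually.of_forall fun ε => by simp⟩
  neg_mem' := by
    rintro x ⟨N, hN⟩
    refine ⟨N, ?_⟩
    filter_upwards [hN] with ε h1
    rwa [Pi.neg_apply, norm_neg]

/-- The ideal of `ρ`-negligible nets. -/
def negligibleIdeal : Ideal (moderateRing ρ 𝕜) where
  carrier := {x | IsNegligible ρ (x : I → 𝕜)}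
  add_mem' := IsNegligible.add
  zero_mem' := fun q => Eventually.of_forall fun ε => by
    simpa using pow_nonneg (ρ.pos ε).le q
  smul_mem' := fun c _ hx => IsModerate.mul_negligible c.2 hx

/-- The ring of Robinson-Colombeau generalized numbers over `𝕜` (that is, over `ℝ` or `ℂ`). -/
def RC : Type := moderateRing ρ 𝕜 ⧸ negligibleIdeal ρ 𝕜

instance : CommRing (RC ρ 𝕜) :=
  inferInstanceAs (CommRing (moderateRing ρ 𝕜 ⧸ negligibleIdeal ρ 𝕜))

variable {𝕜}

/-- The generalized number `[x_ε]` of a moderate net `(x_ε)`. -/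
def mk (x : I → 𝕜) (hx : IsModerate ρ x) : RC ρ 𝕜 :=
  Ideal.Quotient.mk (negligibleIdeal ρ 𝕜) ⟨x, hx⟩

/-- `(x_ε)` is a (moderate) representative of `z`, that is `z = [x_ε]`. -/
def IsRep (x : I → 𝕜) (z : RC ρ 𝕜) : Prop :=
  ∃ hx : IsModerate ρ x, mk ρ x hx = z

variable {ρ}

theorem mk_eq_mk_iff {x y : I → 𝕜} (hx : IsModerate ρ x) (hy : IsModerate ρ y) :
    mk ρ x hx = mk ρ y hy ↔ IsNegligible ρ (x - y) :=
  Ideal.Quotient.eq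

theorem IsModerate.norm {x : I → 𝕜} (hx : IsModerate ρ x) :
    IsModerate ρ (fun ε => ‖x ε‖) := by
  obtain ⟨N, hN⟩ := hx
  exact ⟨N, by simpa using hN⟩

theorem IsNegligible.norm_sub {x y : I → 𝕜} (h : IsNegligible ρ (x - y)) :
    IsNegligible ρ ((fun ε => ‖x ε‖) - fun ε => ‖y ε‖) := by
  intro q
  filter_upwards [h q] with ε hε
  exact (abs_norm_sub_norm_le (x ε) (y ε)).trans hε

/-- The absolute value `|[x_ε]| = [|x_ε|]`, a generalized real number. -/
def RC.abs (z : RC ρ 𝕜) : RC ρ ℝ :=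
  Quotient.liftOn' z (fun x => mk ρ (fun ε => ‖(x : I → 𝕜) ε‖) (IsModerate.norm x.2))
    (fun x y h => (mk_eq_mk_iff _ _).2
      (IsNegligible.norm_sub ((mk_eq_mk_iff x.2 y.2).1 (Quotient.sound' h))))

theorem RC.abs_mk {x : I → 𝕜} (hx : IsModerate ρ x) :
    (mk ρ x hx).abs = mk ρ (fun ε => ‖x ε‖) hx.norm := rfl

end Ring

section Order

variable (ρ : Gauge)

/-- `x ≤ y` iff there are representatives with `x_ε ≤ y_ε` for all small `ε`. -/
instance : LE (RC ρ ℝ) :=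
  ⟨fun x y => ∃ x' y' : I → ℝ, IsRep ρ x' x ∧ IsRep ρ y' y ∧ ∀ᶠ ε in atBot, x' ε ≤ y' ε⟩

/-- `x < y` iff `x ≤ y` and `y - x` is invertible. -/
instance : LT (RC ρ ℝ) := ⟨fun x y => x ≤ y ∧ IsUnit (y - x)⟩

theorem Gauge.isModerate (ρ : Gauge) : IsModerate ρ ρ.net :=
  ⟨0, Eventually.of_forall fun ε => by
    simpa [abs_of_pos (ρ.pos ε)] using ρ.le_one ε⟩

/-- The infinitesimal generalized number `dρ = [ρ_ε]`. -/
def dρ : RC ρ ℝ := mk ρ ρ.net ρ.isModerate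

variable {ρ}

/-- The ball `B_r(c)`. -/
def ball (c : RC ρ ℂ) (r : RC ρ ℝ) : Set (RC ρ ℂ) := {z | (z - c).abs < r}

/-- Open sets of the sharp topology, the topology generated by the balls `B_r(c)` with
`r > 0` (`r` ranges over the generalized real numbers, so it may be infinitesimal). -/
def IsSharplyOpen (U : Set (RC ρ ℂ)) : Prop :=
  ∀ c ∈ U, ∃ r : RC ρ ℝ, 0 < r ∧ ball c r ⊆ U

end Order

/-! ### Generalized holomorphic functions -/

section Holomorphic

variable {ρ : Gauge}

/-- `f` is a basic function on `U`: it is defined by a net of maps `f_ε`, that is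
`f([z_ε]) = [f_ε(z_ε)]` for all representatives of all points of `U` (in particular the net
`f_ε(z_ε)` is moderate). A net of maps `f_ε : Ω_ε → ℂ` with `z_ε ∈ Ω_ε` for small `ε`, for all
representatives of all points of `U`, is covered by extending `f_ε` to `ℂ` in any way. -/
def IsBasicOn (U : Set (RC ρ ℂ)) (f : RC ρ ℂ → RC ρ ℂ) : Prop :=
  ∃ F : I → ℂ → ℂ, ∀ z ∈ U, ∀ z' : I → ℂ, IsRep ρ z' z → IsRep ρ (fun ε => F ε (z' ε)) (f z)

/-- `f(z) = f(z₀) + m (z - z₀) + o(z - z₀)` as `z → z₀` in `U`, in the sharp topology. -/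
def HasSharpDerivWithin (U : Set (RC ρ ℂ)) (f : RC ρ ℂ → RC ρ ℂ) (m z₀ : RC ρ ℂ) : Prop :=
  ∀ q : ℕ, ∃ δ : RC ρ ℝ, 0 < δ ∧ ∀ z ∈ U ∩ ball z₀ δ,
    (f z - f z₀ - m * (z - z₀)).abs ≤ dρ ρ ^ q * (z - z₀).abs

/-- Generalized holomorphic functions on `U`: basic functions that have a complex derivative
at every point of `U`. -/
def IsGHF (U : Set (RC ρ ℂ)) (f : RC ρ ℂ → RC ρ ℂ) : Prop :=
  IsBasicOn U f ∧ ∀ z₀ ∈ U, ∃ m : RC ρ ℂ, HasSharpDerivWithin U f m z₀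

end Holomorphic

/-! ### Hypernatural numbers, hyperlimits and hyperseries -/

section Hyperseries

variable (ρ : Gauge)

/-- The set of hypernatural numbers: the generalized real numbers `[n_ε]` with `n_ε ∈ ℕ` for
all `ε`. -/
def hyperN : Set (RC ρ ℝ) := {x | ∃ n : I → ℕ, IsRep ρ (fun ε => (n ε : ℝ)) x}

variable {ρ}

/-- A chosen representative of a hypernatural number by a net of natural numbers. -/
def ni (N : hyperN ρ) : I → ℕ := N.2.choose

theorem isRep_ni (N : hyperN ρ) : IsRep ρ (fun ε => (ni N ε : ℝ)) N.1 := N.2.choose_spec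

/-- `l` is the hyperlimit of the hypersequence `a`. -/
def IsHyperlimit (a : hyperN ρ → RC ρ ℂ) (l : RC ρ ℂ) : Prop :=
  ∀ q : ℕ, ∃ M : hyperN ρ, ∀ n : hyperN ρ, M.1 ≤ n.1 → (a n - l).abs < dρ ρ ^ q

variable (ρ)

/-- Nets `(a_{nε})` that are moderate over hypersums. -/
def IsModerateOverHypersums (a : ℕ → I → ℂ) : Prop :=
  ∀ N : hyperN ρ, IsModerate ρ (fun ε => ∑ n ∈ Finset.range (ni N ε + 1), a n ε)

/-- Equality in the space of sequences for hyperseries: the differences of all the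
hypersums `∑_{n=N}^M` are negligible. -/
instance hyperSeqSetoid : Setoid {a : ℕ → I → ℂ // IsModerateOverHypersums ρ a} where
  r a b := ∀ M N : hyperN ρ,
    IsNegligible ρ (fun ε => ∑ n ∈ Finset.Icc (ni N ε) (ni M ε), (a.1 n ε - b.1 n ε))
  iseqv := by
    refine ⟨fun a M N q => Eventually.of_forall fun ε => ?_, fun {a b} h M N => ?_,
      fun {a b c} h h' M N => ?_⟩
    · simpa using pow_nonneg (ρ.pos ε).le q
    · convert (h M N).neg using 1
      ext ε
      simp
    · convert (h M N).add (h' M N) using 1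
      ext ε
      simp

/-- The space of sequences for complex hyperseries. -/
def HyperSeq : Type := Quotient (hyperSeqSetoid ρ)

variable {ρ}

theorem zero_mem_hyperN : (0 : RC ρ ℝ) ∈ hyperN ρ :=
  ⟨fun _ => 0, ⟨0, Eventually.of_forall fun ε => by simp⟩, by
    simp only [Nat.cast_zero]; rfl⟩

theorem ni_zero : ∀ᶠ ε in atBot, ni (⟨0, zero_mem_hyperN⟩ : hyperN ρ) ε = 0 := by
  obtain ⟨h1, h2⟩ := isRep_ni (⟨0, zero_mem_hyperN⟩ : hyperN ρ)
  have h0 : IsModerate ρ (0 : I → ℝ) := (moderateRing ρ ℝ).zero_mem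
  have h3 : mk ρ _ h1 = mk ρ 0 h0 := h2
  have h4 := (mk_eq_mk_iff h1 h0).1 h3 1
  filter_upwards [h4, ρ.eventually_two_mul_le] with ε h5 h6
  simp only [sub_zero, pow_one, Real.norm_natCast] at h5
  by_contra h7
  have : (1 : ℝ) ≤ ni (⟨0, zero_mem_hyperN⟩ : hyperN ρ) ε := by
    exact_mod_cast Nat.one_le_iff_ne_zero.2 h7
  have := ρ.pos ε
  linarith

/-- The hypersum `∑_{n=0}^N a_n = [∑_{n=0}^{ni(N)_ε} a_{nε}]`. -/
def HyperSeq.partialSum (a : HyperSeq ρ) (N : hyperN ρ) : RC ρ ℂ :=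
  Quotient.liftOn a (fun a => mk ρ _ (a.2 N)) (by
    intro a b h
    refine (mk_eq_mk_iff _ _).2 fun q => ?_
    filter_upwards [h N ⟨0, zero_mem_hyperN⟩ q, ni_zero (ρ := ρ)] with ε h1 h2
    rw [h2] at h1
    rw [Pi.sub_apply, ← Finset.sum_sub_distrib, Finset.range_eq_Ico]
    exact h1)

/-- `s` is the sum of the hyperseries with terms `a`. -/
def HyperSeq.HasSum (a : HyperSeq ρ) (s : RC ρ ℂ) : Prop :=
  IsHyperlimit a.partialSum s

end Hyperseries

/-! ### Hyper-power series -/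

section HPS

variable (ρ : Gauge)

/-- Equality of the nets of extended real numbers modulo negligible nets. The two inequalities
express `|x_ε - y_ε| ≤ ρ_ε^q`, where `+∞` and `-∞` are at distance `0` from themselves
and at infinite distance from all other points. -/
def extSetoid : Setoid (I → EReal) where
  r x y := ∀ q : ℕ, ∀ᶠ ε in atBot,
    x ε ≤ y ε + ((ρ ε ^ q : ℝ) : EReal) ∧ y ε ≤ x ε + ((ρ ε ^ q : ℝ) : EReal)
  iseqv := by
    refine ⟨fun x q => Eventually.of_forall fun ε => ?_, fun {x y} h q => ?_,
      fun {x y z} h h' q => ?_⟩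
    · have : (0 : EReal) ≤ ((ρ ε ^ q : ℝ) : EReal) :=
        EReal.coe_nonneg.2 (pow_nonneg (ρ.pos ε).le q)
      exact ⟨le_add_of_nonneg_right this, le_add_of_nonneg_right this⟩
    · filter_upwards [h q] with ε hε
      exact hε.symm
    · filter_upwards [h (q + 1), h' (q + 1), ρ.eventually_two_mul_pow q] with ε h1 h2 h3
      have h4 : ((ρ ε ^ (q + 1) : ℝ) : EReal) + ((ρ ε ^ (q + 1) : ℝ) : EReal)
          ≤ ((ρ ε ^ q : ℝ) : EReal) := by
        rw [← EReal.coe_add]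
        exact EReal.coe_le_coe_iff.2 h3
      constructor
      · calc x ε ≤ y ε + ((ρ ε ^ (q + 1) : ℝ) : EReal) := h1.1
          _ ≤ z ε + ((ρ ε ^ (q + 1) : ℝ) : EReal) + ((ρ ε ^ (q + 1) : ℝ) : EReal) :=
              add_le_add_left h2.1 _
          _ ≤ z ε + ((ρ ε ^ q : ℝ) : EReal) := by
              rw [add_assoc]
              exact add_le_add_right h4 _
      · calc z ε ≤ y ε + ((ρ ε ^ (q + 1) : ℝ) : EReal) := h2.2
          _ ≤ x ε + ((ρ ε ^ (q + 1) : ℝ) : EReal) + ((ρ ε ^ (q + 1) : ℝ) : EReal) :=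
              add_le_add_left h1.2 _
          _ ≤ x ε + ((ρ ε ^ q : ℝ) : EReal) := by
              rw [add_assoc]
              exact add_le_add_right h4 _

/-- The extended generalized real numbers: arbitrary nets in `[-∞,+∞]` modulo negligible
nets. -/
def ExtRC : Type := Quotient (extSetoid ρ)

/-- `x < y` iff `x_ε + ρ_ε^m ≤ y_ε` for some `m`, some representatives and all small `ε`. On
(moderate) generalized real numbers this says that `x ≤ y` and `y - x` is invertible. -/
instance : LT (ExtRC ρ) :=
  ⟨fun x y => ∃ x' y' : I → EReal, Quotient.mk (extSetoid ρ) x' = x ∧ Quotient.mk (extSetoid ρ) y' = y ∧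
    ∃ m : ℕ, ∀ᶠ ε in atBot, x' ε + ((ρ ε ^ m : ℝ) : EReal) ≤ y' ε⟩

variable {ρ}

/-- The embedding of the generalized real numbers into the extended ones. -/
def RC.toExt (x : RC ρ ℝ) : ExtRC ρ :=
  Quotient.liftOn' x (fun x => Quotient.mk (extSetoid ρ) fun ε => (((x : I → ℝ) ε : ℝ) : EReal)) (by
    intro x y h
    have h' := (mk_eq_mk_iff x.2 y.2).1 (Quotient.sound' h)
    refine Quotient.sound (s := extSetoid ρ) fun q => ?_
    filter_upwards [h' q] with ε hε
    have h1 := abs_le.1 ((Real.norm_eq_abs _).symm.trans_le hε)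
    rw [Pi.sub_apply] at h1
    rw [← EReal.coe_add, ← EReal.coe_add, EReal.coe_le_coe_iff, EReal.coe_le_coe_iff]
    constructor <;> linarith [h1.1, h1.2])

variable (ρ)

/-- Weakly moderate nets of coefficients. -/
def IsWeaklyModerate (a : ℕ → I → ℂ) : Prop :=
  ∃ Q R : ℕ, ∀ᶠ ε in atBot, ∀ n : ℕ, ‖a n ε‖ ≤ (ρ ε)⁻¹ ^ (n * Q + R)

/-- Strong equivalence of nets of coefficients. -/
instance coeffSetoid : Setoid {a : ℕ → I → ℂ // IsWeaklyModerate ρ a} where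
  r a b := ∀ q r : ℕ, ∀ᶠ ε in atBot, ∀ n : ℕ, ‖a.1 n ε - b.1 n ε‖ ≤ ρ ε ^ (n * q + r)
  iseqv := by
    refine ⟨fun a q r => Eventually.of_forall fun ε n => ?_, fun {a b} h q r => ?_,
      fun {a b c} h h' q r => ?_⟩
    · simpa using pow_nonneg (ρ.pos ε).le _
    · filter_upwards [h q r] with ε hε n
      rw [norm_sub_rev]
      exact hε n
    · filter_upwards [h q (r + 1), h' q (r + 1), ρ.eventually_two_mul_le] with ε h1 h2 h3 n
      have h4 := mul_le_mul_of_nonneg_left h3 (pow_nonneg (ρ.pos ε).le (n * q + r))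
      have h5 := h1 n
      have h6 := h2 n
      rw [← add_assoc, pow_succ] at h5 h6
      have h7 := norm_sub_le_norm_sub_add_norm_sub (a.1 n ε) (b.1 n ε) (c.1 n ε)
      linarith

/-- The coefficients for hyper-power series: weakly moderate nets modulo strong
equivalence. -/
def Coeff : Type := Quotient (coeffSetoid ρ)

variable {ρ}

/-- `(a_{nε})` is a (weakly moderate) representative of the coefficients `a`. -/
def Coeff.IsRep (a' : ℕ → I → ℂ) (a : Coeff ρ) : Prop :=
  ∃ h : IsWeaklyModerate ρ a', (⟦⟨a', h⟩⟧ : Coeff ρ) = a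

variable (ρ)

/-- The radius of convergence `[(limsup_n |a_{nε}|^{1/n})⁻¹]` of a net of coefficients, with
values in `[0,+∞]` at each `ε`. -/
def radius (a : ℕ → I → ℂ) : ExtRC ρ :=
  Quotient.mk (extSetoid ρ) fun ε =>
    (((limsup (fun n : ℕ => ENNReal.ofReal (‖a n ε‖ ^ (1 / (n : ℝ)))) atTop)⁻¹ : ENNReal) : EReal)

variable {ρ}

/-- The hyper-power series with terms `a_{nε} (z_ε - c_ε)^n` is formal, i.e. moderate over
hypersums, and its hyperseries has sum `s`. -/
def HasHPSSum (a : ℕ → I → ℂ) (z c : I → ℂ) (s : RC ρ ℂ) : Prop :=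
  ∃ h : IsModerateOverHypersums ρ (fun n ε => a n ε * (z ε - c ε) ^ n),
    HyperSeq.HasSum (⟦⟨_, h⟩⟧ : HyperSeq ρ) s

/-- The set of convergence of the hyper-power series `∑ a_n (z - c)^n`: the points `z` with
`|z - c| < rad (a_n)` for which, for some representatives of `z`, `a`, `c`, the hyper-power series
is formal, has the sum `[∑_{n=0}^{+∞} a_{nε} (z_ε - c_ε)^n]` (a moderate net), and for every
representative of `z` the net of derivatives of the `ε`-wise power series is moderate. As
`|z - c| < rad (a_n)`, the `ε`-wise power series converge near `z_ε` for all small `ε`. -/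
def setConv (a : Coeff ρ) (c : RC ρ ℂ) : Set (RC ρ ℂ) :=
  {z | ∃ (a' : ℕ → I → ℂ) (z' c' : I → ℂ), a.IsRep a' ∧ IsRep ρ z' z ∧ IsRep ρ c' c ∧
    (z - c).abs.toExt < radius ρ a' ∧
    (∃ s : RC ρ ℂ, IsRep ρ (fun ε => ∑' n : ℕ, a' n ε * (z' ε - c' ε) ^ n) s ∧
      HasHPSSum a' z' c' s) ∧
    ∀ w : I → ℂ, IsRep ρ w z →
      IsModerate ρ (fun ε => deriv (fun ζ : ℂ => ∑' n : ℕ, a' n ε * (ζ - c' ε) ^ n) (w ε))}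

/-- `f(z) = ∑ a_n (z - c)^n`, summed over the hypernatural numbers, for all the representatives
of `a`, `z` and `c`. -/
def EqHPS (fz : RC ρ ℂ) (a : Coeff ρ) (z c : RC ρ ℂ) : Prop :=
  ∀ (a' : ℕ → I → ℂ) (z' c' : I → ℂ), a.IsRep a' → IsRep ρ z' z → IsRep ρ c' c →
    HasHPSSum a' z' c' fz

/-- Generalized complex analytic functions on `U`. -/
def IsGCAF (U : Set (RC ρ ℂ)) (f : RC ρ ℂ → RC ρ ℂ) : Prop :=
  ∀ c ∈ U, ∃ (s : RC ρ ℝ) (a : Coeff ρ), 0 < s ∧ ball c s ⊆ U ∩ setConv a c ∧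
    ∀ z ∈ ball c s, EqHPS (f z) a z c

end HPS

end RobinsonColombeau

end

/-!
Goursat's theorem for generalized holomorphic functions: no continuity, let alone measurability, is
known of the maps `F_ε` that define `f`, so the proof replaces Cauchy's integrals by finite sums over
roots of unity.

*From points to discs.* Since `f` is differentiable at every generalized point, a bad choice of
ordinary points, made for arbitrarily small `ε`, can be assembled to one generalized point at which
`f` would not be moderate or not be differentiable. Hence on a disc of radius `ρ^m` the `F_ε` are
bounded by a fixed power of `1/ρ` (`exists_uniform_bound`), and for every `q` the increments of `F_ε`
are complex linear with relative error `ρ^q` on all scales between `ρ^p` and `ρ^k`, where `p` depends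
on `q` only and `k` is arbitrary (`exists_uniform_approx_deriv`).

*A discrete Cauchy formula.* For fixed `ε`, contract the regular `n`-gon in the circle towards a point
`y`. The derivative at a vertex converts the radial increment of the function into its increment along
an edge, and the increments along the edges add up to zero. So the Cauchy sum is almost constant
during the contraction (`norm_cauchySum_add_sub_le`); at the beginning it is the value at `y` of the
polynomial that interpolates the function at the vertices, at the end it is close to the function
itself (`exists_polynomial_norm_sub_eval_le`).

*The coefficients.* For every `q` and small `ε` this gives a polynomial within `ρ^q` of `F_ε`, with
coefficients `a_n` bounded by `ρ^{-nm-N}`. Choosing the best available `q` at each `ε`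
(`exists_net_forall_eventually`) gives one net of polynomials that represents `f` on a ball
(`exists_polynomial_net`). The bound on the coefficients makes the terms of the hyperseries decrease
geometrically on the smaller ball, whence its convergence, for all representatives.
-/

noncomputable section

namespace RobinsonColombeau

/-! ### Asymptotic estimates and selection of nets -/

theorem Gauge.eventually_mul_pow_succ_le (ρ : Gauge) (C : ℝ) (q : ℕ) :
    ∀ᶠ ε in atBot, C * ρ ε ^ (q + 1) ≤ ρ ε ^ q := by
  have h : ∀ᶠ ε in atBot, |C| * ρ ε < 1 := by
    have := (ρ.tendsto_zero.const_mul |C|)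
    rw [mul_zero] at this
    exact this.eventually (gt_mem_nhds one_pos)
  filter_upwards [h] with ε hε
  have h1 := pow_nonneg (ρ.pos ε).le q
  have h2 : C * ρ ε ≤ 1 :=
    (mul_le_mul_of_nonneg_right (le_abs_self C) (ρ.pos ε).le).trans hε.le
  calc C * ρ ε ^ (q + 1) = C * ρ ε * ρ ε ^ q := by ring
    _ ≤ 1 * ρ ε ^ q := mul_le_mul_of_nonneg_right h2 h1
    _ = ρ ε ^ q := one_mul _

theorem eventually_le_floor_inv (k : ℕ) : ∀ᶠ ε : I in atBot, k ≤ ⌊(ε : ℝ)⁻¹⌋₊ := by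
  have h : (0 : ℝ) < ((k : ℝ) + 1)⁻¹ := by positivity
  refine Filter.eventually_atBot.2 ⟨⟨((k : ℝ) + 1)⁻¹, h, inv_le_one_of_one_le₀ (by simp)⟩, ?_⟩
  intro ε hε
  have h1 : (ε : ℝ) ≤ ((k : ℝ) + 1)⁻¹ := hε
  refine Nat.le_floor ?_
  have h2 := (le_inv_comm₀ ε.2.1 (by positivity)).1 h1
  linarith

/-- Conditions `S p` that each hold for arbitrarily small `ε` can be served by one net: there is a
labelling of the indices for which `S p` holds for arbitrarily small `ε` with the label `p`. -/
theorem exists_labelling {S : ℕ → I → Prop} (hS : ∀ p, ∃ᶠ ε in atBot, S p ε) :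
    ∃ σ : I → ℕ, ∀ p, ∃ᶠ ε in atBot, σ ε = p ∧ S p ε := by
  have h : ∀ n : ℕ, ∃ᶠ k : ℕ in atTop,
      ∃ ε : I, ⌊(ε : ℝ)⁻¹⌋₊ = k ∧ S n.unpair.1 ε := by
    intro n
    refine Filter.frequently_atTop.2 fun k => ?_
    obtain ⟨ε, hε, hk⟩ := ((hS n.unpair.1).and_eventually (eventually_le_floor_inv k)).exists
    exact ⟨_, hk, ε, rfl, hε⟩
  obtain ⟨φ, hφ, hφ'⟩ := extraction_forall_of_frequently h
  choose e he he' using hφ'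
  refine ⟨fun ε => (Function.invFun φ ⌊(ε : ℝ)⁻¹⌋₊).unpair.1, fun p => ?_⟩
  refine Filter.frequently_atBot.2 fun ε₀ => ?_
  set j := ⌊(ε₀ : ℝ)⁻¹⌋₊ + 1
  refine ⟨e (Nat.pair p j), ?_, ?_, ?_⟩
  · have h1 : j ≤ ⌊((e (Nat.pair p j) : I) : ℝ)⁻¹⌋₊ := by
      rw [he]
      exact (Nat.right_le_pair p j).trans hφ.le_apply
    have h2 : (ε₀ : ℝ)⁻¹ ≤ ((e (Nat.pair p j) : I) : ℝ)⁻¹ :=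
      (Nat.lt_floor_add_one _).le.trans ((by simp [j] : _ ≤ (j : ℝ)).trans
        ((Nat.le_floor_iff (inv_nonneg.2 (e _).2.1.le)).1 h1))
    exact (inv_le_inv₀ ε₀.2.1 (e _).2.1).1 h2
  · simp [he, Function.leftInverse_invFun hφ.injective _]
  · simpa using he' (Nat.pair p j)

/-- Objects that satisfy ever stronger conditions `P q`, each for all small `ε`, can be replaced
by one net that satisfies all of them. -/
theorem exists_net_forall_eventually {α : Type*} [Inhabited α] {P : ℕ → I → α → Prop}
    (hmono : ∀ p q ε x, p ≤ q → P q ε x → P p ε x)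
    (hP : ∀ q, ∀ᶠ ε in atBot, ∃ x, P q ε x) :
    ∃ x : I → α, ∀ q, ∀ᶠ ε in atBot, P q ε (x ε) := by
  classical
  -- the strongest condition that can be satisfied at `ε`, below a bound that makes it exist
  set Q : I → ℕ := fun ε => Nat.findGreatest (fun q => ∃ x, P q ε x) ⌊(ε : ℝ)⁻¹⌋₊
  refine ⟨fun ε => if h : ∃ x, P (Q ε) ε x then h.choose else default, fun q => ?_⟩
  filter_upwards [hP q, eventually_le_floor_inv q] with ε h1 h2
  have h3 : ∃ x, P (Q ε) ε x := Nat.findGreatest_spec (P := fun q => ∃ x, P q ε x) h2 h1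
  have h4 : q ≤ Q ε := Nat.le_findGreatest h2 h1
  rw [dif_pos h3]
  exact hmono _ _ _ _ h4 h3.choose_spec

/-! ### Generalized numbers and their representatives -/

section Rep

variable {ρ : Gauge} {𝕜 : Type} [NormedField 𝕜]

theorem IsRep.sub_negligible {x y : I → 𝕜} {z : RC ρ 𝕜} (hx : IsRep ρ x z) (hy : IsRep ρ y z) :
    IsNegligible ρ (x - y) := by
  obtain ⟨hx, rfl⟩ := hx
  obtain ⟨hy, h⟩ := hy
  exact (mk_eq_mk_iff hx hy).1 h.symm

theorem IsNegligible.isModerate {x : I → 𝕜} (hx : IsNegligible ρ x) : IsModerate ρ x := by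
  refine ⟨0, ?_⟩
  filter_upwards [hx 0] with ε hε
  simpa using hε

theorem IsRep.of_sub_negligible {x y : I → 𝕜} {z : RC ρ 𝕜} (hx : IsRep ρ x z)
    (h : IsNegligible ρ (y - x)) : IsRep ρ y z := by
  obtain ⟨hx, rfl⟩ := hx
  have hy : IsModerate ρ y := by simpa using h.isModerate.add hx
  exact ⟨hy, (mk_eq_mk_iff hy hx).2 h⟩

theorem exists_isRep (z : RC ρ 𝕜) : ∃ x, IsRep ρ x z := by
  obtain ⟨x, rfl⟩ := Ideal.Quotient.mk_surjective (I := negligibleIdeal ρ 𝕜) z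
  exact ⟨x, x.2, rfl⟩

theorem IsRep.add {x y : I → 𝕜} {z w : RC ρ 𝕜} (hx : IsRep ρ x z) (hy : IsRep ρ y w) :
    IsRep ρ (x + y) (z + w) := by
  obtain ⟨hx, rfl⟩ := hx
  obtain ⟨hy, rfl⟩ := hy
  exact ⟨hx.add hy, rfl⟩

theorem IsRep.sub {x y : I → 𝕜} {z w : RC ρ 𝕜} (hx : IsRep ρ x z) (hy : IsRep ρ y w) :
    IsRep ρ (x - y) (z - w) := by
  obtain ⟨hx, rfl⟩ := hx
  obtain ⟨hy, rfl⟩ := hy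
  exact ⟨(moderateRing ρ 𝕜).sub_mem hx hy, rfl⟩

theorem IsRep.mul {x y : I → 𝕜} {z w : RC ρ 𝕜} (hx : IsRep ρ x z) (hy : IsRep ρ y w) :
    IsRep ρ (x * y) (z * w) := by
  obtain ⟨hx, rfl⟩ := hx
  obtain ⟨hy, rfl⟩ := hy
  exact ⟨hx.mul hy, rfl⟩

theorem isRep_zero : IsRep ρ (0 : I → 𝕜) 0 := ⟨(moderateRing ρ 𝕜).zero_mem, rfl⟩

theorem isRep_one : IsRep ρ (1 : I → 𝕜) 1 := ⟨(moderateRing ρ 𝕜).one_mem, rfl⟩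

theorem IsRep.abs {x : I → 𝕜} {z : RC ρ 𝕜} (hx : IsRep ρ x z) :
    IsRep ρ (fun ε => ‖x ε‖) z.abs := by
  obtain ⟨hx, rfl⟩ := hx
  exact ⟨hx.norm, (RC.abs_mk hx).symm⟩

theorem isRep_dρ_pow (q : ℕ) : IsRep ρ (fun ε => ρ ε ^ q) (dρ ρ ^ q) := by
  induction q with
  | zero => simp only [pow_zero]; exact isRep_one
  | succ q ih =>
    simp only [pow_succ]
    exact ih.mul ⟨ρ.isModerate, rfl⟩

theorem isModerate_of_eventually_le {x : I → 𝕜} {C : ℝ} {N : ℕ}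
    (h : ∀ᶠ ε in atBot, ‖x ε‖ ≤ C * (ρ ε)⁻¹ ^ N) : IsModerate ρ x := by
  refine ⟨N + 1, ?_⟩
  filter_upwards [h, ρ.eventually_mul_pow_succ_le C 0] with ε h1 h2
  have h3 := ρ.pos ε
  have h4 : C ≤ (ρ ε)⁻¹ := by
    rw [inv_eq_one_div, le_div_iff₀ h3]; simpa using h2
  rw [pow_succ']
  exact h1.trans (by gcongr)

end Rep

section OrderRep

variable {ρ : Gauge}

theorem eventually_le_add_of_le {x y : RC ρ ℝ} {x' y' : I → ℝ} (hx : IsRep ρ x' x)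
    (hy : IsRep ρ y' y) (h : x ≤ y) (j : ℕ) : ∀ᶠ ε in atBot, x' ε ≤ y' ε + ρ ε ^ j := by
  obtain ⟨x₀, y₀, hx₀, hy₀, h⟩ := h
  filter_upwards [h, hx.sub_negligible hx₀ (j + 1), hy.sub_negligible hy₀ (j + 1),
    ρ.eventually_two_mul_pow j] with ε h1 h2 h3 h4
  rw [Real.norm_eq_abs] at h2 h3
  have h5 := (abs_le.1 h2).2
  have h6 := (abs_le.1 h3).1
  simp only [Pi.sub_apply] at h5 h6
  linarith

theorem lt_of_eventually_add_le {x y : RC ρ ℝ} {x' y' : I → ℝ} (hx : IsRep ρ x' x)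
    (hy : IsRep ρ y' y) {k : ℕ} (h : ∀ᶠ ε in atBot, x' ε + ρ ε ^ k ≤ y' ε) : x < y := by
  refine ⟨⟨x', y', hx, hy, ?_⟩, ?_⟩
  · filter_upwards [h] with ε h1
    linarith [pow_pos (ρ.pos ε) k]
  · have hinv : IsModerate ρ (y' - x')⁻¹ := by
      refine ⟨k, ?_⟩
      filter_upwards [h] with ε h1
      have h2 := pow_pos (ρ.pos ε) k
      have h3 : ρ ε ^ k ≤ y' ε - x' ε := by linarith
      rw [Pi.inv_apply, Pi.sub_apply, norm_inv, Real.norm_eq_abs, abs_of_pos (h2.trans_le h3),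
        inv_pow]
      exact inv_anti₀ h2 h3
    have h1 : IsRep ρ (y' - x')⁻¹ (mk ρ _ hinv) := ⟨hinv, rfl⟩
    have h2 := (hy.sub hx).mul h1
    have h3 : IsRep ρ ((y' - x') * (y' - x')⁻¹) (1 : RC ρ ℝ) := by
      refine isRep_one.of_sub_negligible fun q => ?_
      filter_upwards [h] with ε h4
      have h5 := pow_pos (ρ.pos ε) k
      have h6 : y' ε - x' ε ≠ 0 := by linarith
      simpa [h6] using pow_nonneg (ρ.pos ε).le q
    obtain ⟨h4, h5⟩ := h2
    obtain ⟨h6, h7⟩ := h3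
    exact IsUnit.of_mul_eq_one (mk ρ _ hinv) (h5.symm.trans h7)

theorem exists_eventually_add_le_of_lt {x y : RC ρ ℝ} {x' y' : I → ℝ} (hx : IsRep ρ x' x)
    (hy : IsRep ρ y' y) (h : x < y) : ∃ k : ℕ, ∀ᶠ ε in atBot, x' ε + ρ ε ^ k ≤ y' ε := by
  obtain ⟨h1, h2⟩ := h
  obtain ⟨w, hw⟩ := h2.exists_right_inv
  obtain ⟨w', hw'⟩ := exists_isRep w
  have h3 := (hy.sub hx).mul hw'
  rw [hw] at h3
  have h4 := h3.sub_negligible isRep_one 1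
  obtain ⟨N, hN⟩ := hw'.1
  refine ⟨N + 1, ?_⟩
  filter_upwards [h4, hN, eventually_le_add_of_le hx hy h1 (N + 1),
    ρ.eventually_mul_pow_succ_le 4 N, ρ.eventually_two_mul_le] with ε h5 h6 h7 h8 h9
  have h10 := ρ.pos ε
  simp only [Pi.sub_apply, Pi.mul_apply, Pi.one_apply, pow_one, Real.norm_eq_abs] at h5
  have h11 : 1 / 2 ≤ |y' ε - x' ε| * |w' ε| := by
    rw [← abs_mul]
    have := (abs_le.1 h5).1
    exact le_trans (by linarith) (le_abs_self _)
  have h12 : |y' ε - x' ε| * |w' ε| ≤ |y' ε - x' ε| * (ρ ε)⁻¹ ^ N :=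
    mul_le_mul_of_nonneg_left h6 (abs_nonneg _)
  have h13 : ρ ε ^ N / 2 ≤ |y' ε - x' ε| := by
    have h14 := h11.trans h12
    rw [inv_pow, ← div_eq_mul_inv, le_div_iff₀ (pow_pos h10 N)] at h14
    linarith
  have h15 := pow_pos h10 (N + 1)
  rcases abs_cases (y' ε - x' ε) with ⟨h16, h17⟩ | ⟨h16, h17⟩ <;> linarith

end OrderRep

/-! ### A discrete Cauchy formula in the unit disc -/

open Polynomial in
/-- The polynomial of degree `< n` that interpolates `Φ` at the powers of `ζ`, when `ζ` is a
primitive `n`-th root of unity. Its coefficients are the Riemann sums of Cauchy's integrals for the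
Taylor coefficients. -/
def cauchyPolynomial (Φ : ℂ → ℂ) (ζ : ℂ) (n : ℕ) : ℂ[X] :=
  ∑ j ∈ Finset.range n,
    C ((n : ℂ)⁻¹ * ∑ k ∈ Finset.range n, Φ (ζ ^ k) * ((ζ ^ k)⁻¹) ^ j) * X ^ j

/-- The truncated Cauchy kernel `∑_{j<n} (y / ζ^k)^j`, which equals
`(1 - y^n) ζ^k / (ζ^k - y)` when `ζ^n = 1`. Owing to the truncation, its mean over the `n`-th roots
of unity is exactly `1`. -/
def cauchyKernel (ζ y : ℂ) (n k : ℕ) : ℂ := ∑ j ∈ Finset.range n, (y * (ζ ^ k)⁻¹) ^ j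

theorem sub_mul_cauchyKernel {ζ : ℂ} {n : ℕ} (hn : n ≠ 0) (hζ : ζ ^ n = 1) (y : ℂ) (k : ℕ) :
    (ζ ^ k - y) * cauchyKernel ζ y n k = (1 - y ^ n) * ζ ^ k := by
  have h0 : ζ ≠ 0 := by rintro rfl; simp [hn] at hζ
  have hk : ζ ^ k ≠ 0 := pow_ne_zero _ h0
  have h1 := mul_neg_geom_sum (y * (ζ ^ k)⁻¹) n
  have h2 : (y * (ζ ^ k)⁻¹) ^ n = y ^ n := by
    rw [mul_pow, inv_pow, ← pow_mul, mul_comm k n, pow_mul, hζ]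
    simp
  rw [h2] at h1
  rw [← h1, cauchyKernel]
  field_simp

theorem norm_cauchyKernel_le {ζ y : ℂ} (hζ : ‖ζ‖ = 1) (hy : ‖y‖ ≤ 1 / 2) (n k : ℕ) :
    ‖cauchyKernel ζ y n k‖ ≤ 2 := by
  calc ‖cauchyKernel ζ y n k‖ ≤ ∑ j ∈ Finset.range n, ‖(y * (ζ ^ k)⁻¹) ^ j‖ := norm_sum_le _ _
    _ ≤ ∑ j ∈ Finset.range n, (1 / 2 : ℝ) ^ j := by
        refine Finset.sum_le_sum fun j _ => ?_
        rw [norm_pow, norm_mul, norm_inv, norm_pow, hζ]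
        simp only [one_pow, inv_one, mul_one]
        gcongr
    _ ≤ 2 := sum_geometric_two_le n

theorem sum_cauchyKernel {ζ : ℂ} {n : ℕ} (hn : n ≠ 0) (hζ : IsPrimitiveRoot ζ n) (y : ℂ) :
    ∑ k ∈ Finset.range n, cauchyKernel ζ y n k = n := by
  unfold cauchyKernel
  rw [Finset.sum_comm, Finset.sum_eq_single_of_mem 0 (by simpa using Nat.pos_of_ne_zero hn)]
  · simp
  · intro j hj hj0
    have h1 : ζ⁻¹ ^ j ≠ 1 :=
      hζ.inv.pow_ne_one_of_pos_of_lt hj0 (Finset.mem_range.1 hj)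
    have h2 : ∑ k ∈ Finset.range n, (ζ⁻¹ ^ j) ^ k = 0 := by
      rw [geom_sum_eq h1, ← pow_mul, mul_comm, pow_mul, hζ.inv.pow_eq_one]
      simp
    have h3 : ∀ k ∈ Finset.range n, (y * (ζ ^ k)⁻¹) ^ j = y ^ j * (ζ⁻¹ ^ j) ^ k := by
      intro k _
      rw [mul_pow, ← inv_pow, ← pow_mul, ← pow_mul, mul_comm k j]
    rw [Finset.sum_congr rfl h3, ← Finset.mul_sum, h2, mul_zero]

/-- The Cauchy sum of `Φ` over the `n`-gon that is contracted from the unit circle towards `y` by the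
factor `t`. -/
def cauchySum (Φ : ℂ → ℂ) (ζ y : ℂ) (n : ℕ) (t : ℝ) : ℂ :=
  (n : ℂ)⁻¹ * ∑ k ∈ Finset.range n, Φ (y + t * (ζ ^ k - y)) * cauchyKernel ζ y n k

theorem eval_cauchyPolynomial (Φ : ℂ → ℂ) (ζ y : ℂ) (n : ℕ) :
    (cauchyPolynomial Φ ζ n).eval y = cauchySum Φ ζ y n 1 := by
  simp only [cauchyPolynomial, cauchySum, cauchyKernel, Polynomial.eval_finsetSum,
    Polynomial.eval_mul, Polynomial.eval_C, Polynomial.eval_pow, Polynomial.eval_X,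
    Complex.ofReal_one, one_mul, add_sub_cancel, Finset.mul_sum, Finset.sum_mul]
  rw [Finset.sum_comm]
  refine Finset.sum_congr rfl fun k _ => Finset.sum_congr rfl fun j _ => ?_
  rw [mul_pow]
  ring

theorem norm_coeff_cauchyPolynomial_le {Φ : ℂ → ℂ} {ζ : ℂ} {n : ℕ} {A : ℝ} (hn : n ≠ 0)
    (hζ : ‖ζ‖ = 1) (hA : ∀ x, ‖x‖ ≤ 1 → ‖Φ x‖ ≤ A) (j : ℕ) :
    ‖(cauchyPolynomial Φ ζ n).coeff j‖ ≤ A := by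
  have hA0 : 0 ≤ A := (norm_nonneg _).trans (hA 0 (by simp))
  simp only [cauchyPolynomial, Polynomial.finsetSum_coeff, Polynomial.coeff_C_mul_X_pow,
    Finset.sum_ite_eq, Finset.mem_range]
  split_ifs
  · have h1 : ‖∑ k ∈ Finset.range n, Φ (ζ ^ k) * ((ζ ^ k)⁻¹) ^ j‖ ≤ n * A := by
      refine (norm_sum_le_of_le (n := fun _ => A) _ fun k _ => ?_).trans_eq (by simp)
      rw [norm_mul, norm_pow, norm_inv, norm_pow, hζ]
      simpa using hA (ζ ^ k) (by simp [hζ])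
    have hn' : (0 : ℝ) < n := by exact_mod_cast Nat.pos_of_ne_zero hn
    rw [norm_mul, norm_inv, Complex.norm_natCast, inv_mul_le_iff₀ hn']
    exact h1
  · simpa using hA0

/-- Differentiability on the closed unit disc with error `η`, as far as it can be seen at the
scales in `[h, H]`, with approximate derivatives bounded by `L`. -/
def ApproxDifferentiable (Φ : ℂ → ℂ) (L η h H : ℝ) : Prop :=
  ∀ x, ‖x‖ ≤ 1 → ∃ m : ℂ, ‖m‖ ≤ L ∧ ∀ u, ‖u‖ ≤ 1 → h ≤ ‖u - x‖ → ‖u - x‖ ≤ H →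
    ‖Φ u - Φ x - m * (u - x)‖ ≤ η * ‖u - x‖

theorem norm_contract_le_one {ζ y : ℂ} (hζ : ‖ζ‖ = 1) (hy : ‖y‖ ≤ 1 / 2) (k : ℕ) {t : ℝ}
    (ht : 0 ≤ t) (ht' : t ≤ 1) : ‖y + t * (ζ ^ k - y)‖ ≤ 1 := by
  have h1 : y + t * (ζ ^ k - y) = ((1 - t : ℝ) : ℂ) * y + (t : ℂ) * ζ ^ k := by
    push_cast; ring
  rw [h1]
  refine (norm_add_le _ _).trans ?_
  rw [norm_mul, norm_mul, norm_pow, hζ, Complex.norm_real, Complex.norm_real, Real.norm_eq_abs,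
    Real.norm_eq_abs, abs_of_nonneg ht, abs_of_nonneg (by linarith)]
  rw [one_pow]
  nlinarith [norm_nonneg y]

theorem norm_pow_sub_bounds {ζ y : ℂ} (hζ : ‖ζ‖ = 1) (hy : ‖y‖ ≤ 1 / 2) (k : ℕ) :
    1 / 2 ≤ ‖ζ ^ k - y‖ ∧ ‖ζ ^ k - y‖ ≤ 3 / 2 := by
  have h1 : ‖ζ ^ k‖ = 1 := by rw [norm_pow, hζ, one_pow]
  have h2 := norm_sub_norm_le (ζ ^ k) y
  have h3 := norm_sub_le (ζ ^ k) y
  constructor <;> linarith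

/-- The Cauchy sum hardly depends on the contraction factor. The approximate derivative at the
`k`-th vertex turns the radial increment of `Φ` into its increment along the `k`-th edge, and
the latter increments add up to `0` around the polygon. -/
theorem norm_cauchySum_add_sub_le {Φ : ℂ → ℂ} {ζ y : ℂ} {n : ℕ} {L η h H t δ : ℝ} (hn : n ≠ 0)
    (hζn : ζ ^ n = 1) (hζ1 : ζ ≠ 1) (hy : ‖y‖ ≤ 1 / 2) (hη : 0 ≤ η)
    (hΦ : ApproxDifferentiable Φ L η h H) (ht : 0 < t) (hδ : 0 < δ) (htδ : t + δ ≤ 1)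
    (hδh : h ≤ δ * (1 / 2)) (hδH : δ * (3 / 2) ≤ H) (hth : h ≤ t * ‖ζ - 1‖)
    (htH : t * ‖ζ - 1‖ ≤ H) :
    ‖cauchySum Φ ζ y n (t + δ) - cauchySum Φ ζ y n t‖ ≤ 5 * η * δ := by
  have hζ : ‖ζ‖ = 1 := Complex.norm_eq_one_of_pow_eq_one hζn hn
  have hn' : (0 : ℝ) < n := by exact_mod_cast Nat.pos_of_ne_zero hn
  have hx : ∀ k, ‖y + t * (ζ ^ k - y)‖ ≤ 1 := fun k =>
    norm_contract_le_one hζ hy k ht.le (by linarith)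
  choose m hmL hm using fun k => hΦ _ (hx k)
  have hζ1' : ζ - 1 ≠ 0 := sub_ne_zero.2 hζ1
  have hζ1'' : 0 < ‖ζ - 1‖ := norm_pos_iff.2 hζ1'
  have htC : (t : ℂ) ≠ 0 := Complex.ofReal_ne_zero.2 ht.ne'
  -- the errors of the radial increments
  have he1 : ∀ k, ‖Φ (y + (t + δ : ℝ) * (ζ ^ k - y)) - Φ (y + t * (ζ ^ k - y))
      - m k * (δ * (ζ ^ k - y))‖ ≤ η * (δ * (3 / 2)) := by
    intro k
    have h1 : y + (t + δ : ℝ) * (ζ ^ k - y) - (y + t * (ζ ^ k - y)) = δ * (ζ ^ k - y) := by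
      push_cast; ring
    obtain ⟨h2, h3⟩ := norm_pow_sub_bounds hζ hy k
    have h4 : ‖(δ : ℂ) * (ζ ^ k - y)‖ = δ * ‖ζ ^ k - y‖ := by
      rw [norm_mul, Complex.norm_real, Real.norm_eq_abs, abs_of_pos hδ]
    have h5 := hm k (y + (t + δ : ℝ) * (ζ ^ k - y))
      (norm_contract_le_one hζ hy k (by linarith) htδ)
    rw [h1, h4] at h5
    refine (h5 (hδh.trans (by gcongr)) (le_trans (by gcongr) hδH)).trans ?_
    gcongr
  -- the errors of the increments along the edges
  have he2 : ∀ k, ‖Φ (y + t * (ζ ^ (k + 1) - y)) - Φ (y + t * (ζ ^ k - y))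
      - m k * (t * (ζ - 1) * ζ ^ k)‖ ≤ η * (t * ‖ζ - 1‖) := by
    intro k
    have h1 : y + t * (ζ ^ (k + 1) - y) - (y + t * (ζ ^ k - y)) = t * (ζ - 1) * ζ ^ k := by
      rw [pow_succ]; ring
    have h4 : ‖(t : ℂ) * (ζ - 1) * ζ ^ k‖ = t * ‖ζ - 1‖ := by
      rw [norm_mul, norm_mul, Complex.norm_real, Real.norm_eq_abs, abs_of_pos ht, norm_pow, hζ,
        one_pow, mul_one]
    have h5 := hm k _ (hx (k + 1))
    rw [h1, h4] at h5
    exact h5 hth htH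
  set e1 : ℕ → ℂ := fun k => Φ (y + (t + δ : ℝ) * (ζ ^ k - y)) - Φ (y + t * (ζ ^ k - y))
      - m k * (δ * (ζ ^ k - y)) with he1_def
  set e2 : ℕ → ℂ := fun k => Φ (y + t * (ζ ^ (k + 1) - y)) - Φ (y + t * (ζ ^ k - y))
      - m k * (t * (ζ - 1) * ζ ^ k) with he2_def
  have htel : ∑ k ∈ Finset.range n,
      (Φ (y + t * (ζ ^ (k + 1) - y)) - Φ (y + t * (ζ ^ k - y))) = 0 := by
    rw [Finset.sum_range_sub (fun k => Φ (y + t * (ζ ^ k - y))), hζn, pow_zero, sub_self]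
  -- the ratio of the weighted radial increment to the increment along the edge, the same for all `k`
  set a : ℂ := (1 - y ^ n) * δ / (t * (ζ - 1)) with ha
  have hterm : ∀ k, (Φ (y + (t + δ : ℝ) * (ζ ^ k - y)) - Φ (y + t * (ζ ^ k - y)))
      * cauchyKernel ζ y n k = a * (Φ (y + t * (ζ ^ (k + 1) - y)) - Φ (y + t * (ζ ^ k - y)))
        + (e1 k * cauchyKernel ζ y n k - a * e2 k) := by
    intro k
    have h1 := sub_mul_cauchyKernel hn hζn y k
    have h2 : a * (t * (ζ - 1)) = (1 - y ^ n) * δ := by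
      rw [ha]; field_simp
    simp only [he1_def, he2_def]
    linear_combination (m k * δ) * h1 - (m k * ζ ^ k) * h2
  have hsum : cauchySum Φ ζ y n (t + δ) - cauchySum Φ ζ y n t
      = (n : ℂ)⁻¹ * ∑ k ∈ Finset.range n, (e1 k * cauchyKernel ζ y n k - a * e2 k) := by
    rw [cauchySum, cauchySum, ← mul_sub, ← Finset.sum_sub_distrib]
    congr 1
    rw [Finset.sum_congr rfl fun k _ => (sub_mul _ _ _).symm.trans (hterm k),
      Finset.sum_add_distrib, ← Finset.mul_sum, htel, mul_zero, zero_add]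
  have hya : ‖1 - y ^ n‖ ≤ 2 := by
    refine (norm_sub_le _ _).trans ?_
    have : ‖y ^ n‖ ≤ 1 := by
      rw [norm_pow]; exact pow_le_one₀ (norm_nonneg _) (by linarith)
    rw [norm_one]; linarith
  have ha_norm : ‖a‖ * (t * ‖ζ - 1‖) ≤ 2 * δ := by
    rw [ha, norm_div, norm_mul, norm_mul, Complex.norm_real, Complex.norm_real,
      Real.norm_eq_abs, Real.norm_eq_abs, abs_of_pos ht, abs_of_pos hδ,
      div_mul_cancel₀ _ (by positivity)]
    gcongr
  have hbound : ∀ k ∈ Finset.range n, ‖e1 k * cauchyKernel ζ y n k - a * e2 k‖ ≤ 5 * η * δ := by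
    intro k _
    refine (norm_sub_le _ _).trans ?_
    rw [norm_mul, norm_mul]
    have h1 : ‖e1 k‖ * ‖cauchyKernel ζ y n k‖ ≤ η * (δ * (3 / 2)) * 2 :=
      mul_le_mul (he1 k) (norm_cauchyKernel_le hζ hy n k) (norm_nonneg _) (by positivity)
    have h2 : ‖a‖ * ‖e2 k‖ ≤ ‖a‖ * (η * (t * ‖ζ - 1‖)) :=
      mul_le_mul_of_nonneg_left (he2 k) (norm_nonneg _)
    have h3 := mul_le_mul_of_nonneg_left ha_norm hη
    linarith
  rw [hsum, norm_mul, norm_inv, Complex.norm_natCast, inv_mul_le_iff₀ hn']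
  exact (norm_sum_le_of_le _ hbound).trans_eq (by simp)

/-- On the half-sized disc, an approximately differentiable function is close to the polynomial that
interpolates it at the `n`-th roots of unity: contracting the polygon from the factor `1` to the
factor `1 / n` hardly changes the Cauchy sum, which then is close to the value at the centre. -/
theorem exists_polynomial_norm_sub_eval_le {Φ : ℂ → ℂ} {A L η h H : ℝ} {n : ℕ} (hn : 2 ≤ n)
    (hη : 0 ≤ η) (hA : ∀ x, ‖x‖ ≤ 1 → ‖Φ x‖ ≤ A) (hΦ : ApproxDifferentiable Φ L η h H)
    (hH : 2 * Real.pi / n ≤ H) (hh : h ≤ 1 / (n : ℝ) ^ 2) :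
    ∃ P : Polynomial ℂ, (∀ j, ‖P.coeff j‖ ≤ A) ∧
      ∀ y, ‖y‖ ≤ 1 / 2 → ‖Φ y - P.eval y‖ ≤ 5 * η + 3 * (L + η) / n := by
  have hn0 : n ≠ 0 := by omega
  have hn2 : (2 : ℝ) ≤ n := by exact_mod_cast hn
  have hn' : (0 : ℝ) < n := by linarith
  set ζ : ℂ := Complex.exp (2 * Real.pi * Complex.I / n) with hζ_def
  have hprim : IsPrimitiveRoot ζ n := Complex.isPrimitiveRoot_exp n hn0
  have hζ : ‖ζ‖ = 1 := hprim.norm'_eq_one hn0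
  have hζ1 : ζ ≠ 1 := hprim.ne_one (by omega)
  have hζI : ζ = Complex.exp (Complex.I * ((2 * Real.pi / n : ℝ) : ℂ)) := by
    rw [hζ_def]; congr 1; push_cast; ring
  have hpi := Real.pi_gt_three
  have hup : ‖ζ - 1‖ ≤ 2 * Real.pi / n := by
    rw [hζI]
    refine (Real.norm_exp_I_mul_ofReal_sub_one_le).trans_eq ?_
    rw [Real.norm_eq_abs, abs_of_pos (by positivity)]
  have hlow : 1 / (n : ℝ) ≤ ‖ζ - 1‖ := by
    rw [hζI, Complex.norm_exp_I_mul_ofReal_sub_one]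
    have h1 : 2 * Real.pi / n / 2 = Real.pi / n := by ring
    have h2 : Real.pi / n ≤ Real.pi / 2 := by gcongr
    have h3 := Real.mul_le_sin (x := Real.pi / n) (by positivity) h2
    have h4 : 2 / Real.pi * (Real.pi / n) = 2 / n := by field_simp
    rw [h1]
    rw [h4] at h3
    have h5 : 0 < 1 / (n : ℝ) := by positivity
    have h6 : 2 / (n : ℝ) = 2 * (1 / n) := by ring
    rw [Real.norm_eq_abs]
    refine le_trans ?_ (le_abs_self _)
    linarith
  have hδ : 0 < 1 / (n : ℝ) := by positivity
  have hδh : h ≤ 1 / (n : ℝ) * (1 / 2) := by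
    refine hh.trans ?_
    rw [one_div_mul_one_div]
    exact one_div_le_one_div_of_le (by positivity) (by nlinarith)
  have hδH : 1 / (n : ℝ) * (3 / 2) ≤ H := by
    refine le_trans ?_ hH
    rw [one_div_mul_eq_div]
    gcongr
    linarith
  refine ⟨cauchyPolynomial Φ ζ n, norm_coeff_cauchyPolynomial_le hn0 hζ hA, fun y hy => ?_⟩
  have hiter : ∀ i : ℕ, i + 1 ≤ n →
      ‖cauchySum Φ ζ y n ((i + 1 : ℕ) / n) - cauchySum Φ ζ y n (1 / n)‖ ≤ 5 * η * (i / n) := by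
    intro i
    induction i with
    | zero => intro _; simp
    | succ i ih =>
      intro hi
      have h1 := ih (by omega)
      have hi' : ((i : ℝ) + 1 + 1) ≤ n := by exact_mod_cast hi
      have h2 : (((i + 1 + 1 : ℕ) : ℝ) / n) = ((i + 1 : ℕ) : ℝ) / n + 1 / n := by
        push_cast; ring
      have h3 : 1 / (n : ℝ) ≤ ((i + 1 : ℕ) : ℝ) / n := by
        gcongr; push_cast; linarith [(Nat.cast_nonneg i : (0 : ℝ) ≤ i)]
      have h4 : ((i + 1 : ℕ) : ℝ) / n ≤ 1 := by
        rw [div_le_one hn']; push_cast; linarith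
      have h5 := norm_cauchySum_add_sub_le (t := ((i + 1 : ℕ) : ℝ) / n) (δ := 1 / n) hn0
        hprim.pow_eq_one hζ1 hy hη hΦ (by positivity) hδ
        (by rw [← h2, div_le_one hn']; push_cast; linarith) hδh hδH
        (hh.trans (by
          rw [pow_two, ← one_div_mul_one_div]
          gcongr))
        (((mul_le_mul_of_nonneg_right h4 (norm_nonneg _)).trans (by rw [one_mul])).trans
          (hup.trans hH))
      rw [h2]
      have h6 : ((i + 1 : ℕ) : ℝ) / n = i / n + 1 / n := by push_cast; ring
      calc _ ≤ _ := norm_sub_le_norm_sub_add_norm_sub _ (cauchySum Φ ζ y n ((i + 1 : ℕ) / n)) _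
        _ ≤ 5 * η * (1 / n) + 5 * η * (i / n) := add_le_add h5 h1
        _ = 5 * η * (((i + 1 : ℕ) : ℝ) / n) := by rw [h6]; ring
  have hcontract : ‖cauchySum Φ ζ y n 1 - cauchySum Φ ζ y n (1 / n)‖ ≤ 5 * η := by
    have h1 := hiter (n - 1) (by omega)
    rw [Nat.sub_add_cancel (by omega), div_self hn'.ne'] at h1
    refine h1.trans (mul_le_of_le_one_right (by positivity) ?_)
    rw [div_le_one hn']
    exact_mod_cast Nat.sub_le n 1
  have hcentre : ‖cauchySum Φ ζ y n (1 / n) - Φ y‖ ≤ 3 * (L + η) / n := by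
    obtain ⟨m, hmL, hm⟩ := hΦ y (by linarith)
    have h1 : cauchySum Φ ζ y n (1 / n) - Φ y = (n : ℂ)⁻¹ * ∑ k ∈ Finset.range n,
        (Φ (y + ((1 / n : ℝ) : ℂ) * (ζ ^ k - y)) - Φ y) * cauchyKernel ζ y n k := by
      simp only [sub_mul, Finset.sum_sub_distrib]
      rw [← Finset.mul_sum, sum_cauchyKernel hn0 hprim, cauchySum, mul_sub]
      congr 1
      have : (n : ℂ) ≠ 0 := by exact_mod_cast hn0
      field_simp
    have h2 : ∀ k ∈ Finset.range n, ‖(Φ (y + ((1 / n : ℝ) : ℂ) * (ζ ^ k - y)) - Φ y)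
        * cauchyKernel ζ y n k‖ ≤ 3 * (L + η) / n := by
      intro k _
      obtain ⟨h3, h4⟩ := norm_pow_sub_bounds hζ hy k
      have h5 : ‖y + ((1 / n : ℝ) : ℂ) * (ζ ^ k - y) - y‖ = 1 / n * ‖ζ ^ k - y‖ := by
        rw [add_sub_cancel_left, norm_mul, Complex.norm_real, Real.norm_eq_abs, abs_of_pos hδ]
      have h6 := hm (y + ((1 / n : ℝ) : ℂ) * (ζ ^ k - y)) (norm_contract_le_one hζ hy k hδ.le
        (by rw [div_le_one hn']; linarith)) (by rw [h5]; exact hδh.trans (by gcongr))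
        (by rw [h5]; exact le_trans (by gcongr) hδH)
      set u := y + ((1 / n : ℝ) : ℂ) * (ζ ^ k - y)
      have h7 : ‖Φ u - Φ y‖ ≤ (L + η) * ‖u - y‖ := by
        have h8 := norm_add_le (Φ u - Φ y - m * (u - y)) (m * (u - y))
        rw [sub_add_cancel, norm_mul] at h8
        have h9 := mul_le_mul_of_nonneg_right hmL (norm_nonneg (u - y))
        linarith
      have hL : 0 ≤ L + η := add_nonneg ((norm_nonneg m).trans hmL) hη
      rw [norm_mul]
      calc _ ≤ (L + η) * ‖u - y‖ * 2 :=
            mul_le_mul h7 (norm_cauchyKernel_le hζ hy n k) (norm_nonneg _) (by positivity)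
        _ ≤ (L + η) * (1 / n * (3 / 2)) * 2 := by rw [h5]; gcongr
        _ = 3 * (L + η) / n := by ring
    rw [h1, norm_mul, norm_inv, Complex.norm_natCast, inv_mul_le_iff₀ hn']
    exact (norm_sum_le_of_le _ h2).trans_eq (by simp)
  rw [eval_cauchyPolynomial, norm_sub_rev]
  calc _ ≤ _ := norm_sub_le_norm_sub_add_norm_sub _ (cauchySum Φ ζ y n (1 / n)) _
    _ ≤ _ := add_le_add hcontract hcentre

/-! ### Uniform estimates for a generalized holomorphic function -/

section Uniform

variable {ρ : Gauge}

theorem exists_pow_disc_subset {U : Set (RC ρ ℂ)} (hU : IsSharplyOpen U) {c : RC ρ ℂ} (hc : c ∈ U)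
    {c' : I → ℂ} (hc' : IsRep ρ c' c) :
    ∃ m : ℕ, ∀ z' : I → ℂ, (∀ᶠ ε in atBot, ‖z' ε - c' ε‖ ≤ ρ ε ^ m) → ∃ z ∈ U, IsRep ρ z' z := by
  obtain ⟨r, hr, hrU⟩ := hU c hc
  obtain ⟨r', hr'⟩ := exists_isRep r
  obtain ⟨k, hk⟩ := exists_eventually_add_le_of_lt isRep_zero hr' hr
  refine ⟨k + 1, fun z' hz' => ?_⟩
  have h1 : IsModerate ρ (z' - c') := by
    refine ⟨0, ?_⟩
    filter_upwards [hz'] with ε h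
    simpa using h.trans (pow_le_one₀ (ρ.pos ε).le (ρ.le_one ε))
  have h2 : IsRep ρ z' (c + mk ρ _ h1) := by
    have := hc'.add (⟨h1, rfl⟩ : IsRep ρ (z' - c') (mk ρ _ h1))
    rwa [add_sub_cancel] at this
  refine ⟨_, hrU ?_, h2⟩
  refine lt_of_eventually_add_le (h2.sub hc').abs hr' (k := k + 1) ?_
  filter_upwards [hk, hz', ρ.eventually_two_mul_pow k] with ε h3 h4 h5
  rw [Pi.zero_apply, zero_add] at h3
  rw [Pi.sub_apply]
  linarith

/-- The basic function `F` is moderate uniformly on a disc: if not, selecting bad points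
gives one point of the disc at which `F` is not moderate. -/
theorem exists_uniform_bound {U : Set (RC ρ ℂ)} {f : RC ρ ℂ → RC ρ ℂ} {F : I → ℂ → ℂ}
    (hF : ∀ z ∈ U, ∀ z' : I → ℂ, IsRep ρ z' z → IsRep ρ (fun ε => F ε (z' ε)) (f z))
    {c' : I → ℂ} {m : ℕ}
    (hm : ∀ z' : I → ℂ, (∀ᶠ ε in atBot, ‖z' ε - c' ε‖ ≤ ρ ε ^ m) → ∃ z ∈ U, IsRep ρ z' z) :
    ∃ N : ℕ, ∀ᶠ ε in atBot, ∀ x, ‖x - c' ε‖ ≤ ρ ε ^ m → ‖F ε x‖ ≤ (ρ ε)⁻¹ ^ N := by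
  classical
  by_contra! hbad
  obtain ⟨σ, hσ⟩ := exists_labelling hbad
  set z' : I → ℂ := fun ε =>
    if h : ∃ x, ‖x - c' ε‖ ≤ ρ ε ^ m ∧ (ρ ε)⁻¹ ^ σ ε < ‖F ε x‖ then h.choose else c' ε with hz'_def
  have hz' : ∀ ε, ‖z' ε - c' ε‖ ≤ ρ ε ^ m := by
    intro ε
    by_cases h : ∃ x, ‖x - c' ε‖ ≤ ρ ε ^ m ∧ (ρ ε)⁻¹ ^ σ ε < ‖F ε x‖
    · simp only [hz'_def, dif_pos h]
      exact h.choose_spec.1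
    · simpa only [hz'_def, dif_neg h, sub_self, norm_zero] using pow_nonneg (ρ.pos ε).le m
  obtain ⟨z, hzU, hz⟩ := hm z' (Eventually.of_forall hz')
  obtain ⟨⟨N, hN⟩, -⟩ := hF z hzU z' hz
  obtain ⟨ε, ⟨h1, h2⟩, h3⟩ := ((hσ N).and_eventually hN).exists
  rw [← h1] at h2
  simp only [hz'_def, dif_pos h2] at h3
  rw [← h1] at h3
  exact h2.choose_spec.2.not_ge h3

/-- The complex derivatives of a generalized holomorphic function are approximated uniformly on a
disc, on all scales from `ρ^p` down to any power of `ρ`, where `p` depends only on the accuracy.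
If not, a labelling assigns to the indices with label `p` a bad point for the exponent `p`, and the
derivative at the resulting generalized point contradicts the choice for a single large `p`. For
this `p` the lower bound `ρ^k` on the scale is fixed, so that negligible errors are harmless. -/
theorem exists_uniform_approx_deriv {U : Set (RC ρ ℂ)} {f : RC ρ ℂ → RC ρ ℂ} {F : I → ℂ → ℂ}
    (hF : ∀ z ∈ U, ∀ z' : I → ℂ, IsRep ρ z' z → IsRep ρ (fun ε => F ε (z' ε)) (f z))
    (hf : ∀ z₀ ∈ U, ∃ m : RC ρ ℂ, HasSharpDerivWithin U f m z₀)
    {c' : I → ℂ} {m : ℕ}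
    (hm : ∀ z' : I → ℂ, (∀ᶠ ε in atBot, ‖z' ε - c' ε‖ ≤ ρ ε ^ m) → ∃ z ∈ U, IsRep ρ z' z) (q : ℕ) :
    ∃ p : ℕ, ∀ k : ℕ, ∀ᶠ ε in atBot, ∀ x, ‖x - c' ε‖ ≤ ρ ε ^ m →
      ∃ a : ℂ, ‖a‖ ≤ (ρ ε)⁻¹ ^ p ∧ ∀ u, ‖u - c' ε‖ ≤ ρ ε ^ m →
        ρ ε ^ k ≤ ‖u - x‖ → ‖u - x‖ ≤ ρ ε ^ p →
        ‖F ε u - F ε x - a * (u - x)‖ ≤ ρ ε ^ q * ‖u - x‖ := by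
  classical
  by_contra! hbad
  choose k hk using hbad
  obtain ⟨σ, hσ⟩ := exists_labelling hk
  set B : ℕ → I → ℂ → Prop := fun p ε x => ‖x - c' ε‖ ≤ ρ ε ^ m ∧
    ∀ a : ℂ, ‖a‖ ≤ (ρ ε)⁻¹ ^ p → ∃ u, ‖u - c' ε‖ ≤ ρ ε ^ m ∧ ρ ε ^ k p ≤ ‖u - x‖ ∧
      ‖u - x‖ ≤ ρ ε ^ p ∧ ρ ε ^ q * ‖u - x‖ < ‖F ε u - F ε x - a * (u - x)‖ with hB
  have hσ' : ∀ p, ∃ᶠ ε in atBot, σ ε = p ∧ ∃ x, B p ε x := hσ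
  set z' : I → ℂ := fun ε => if h : ∃ x, B (σ ε) ε x then h.choose else c' ε with hz'_def
  have hz'_spec : ∀ ε, (∃ x, B (σ ε) ε x) → B (σ ε) ε (z' ε) := by
    intro ε h
    simp only [hz'_def, dif_pos h]
    exact h.choose_spec
  have hz' : ∀ ε, ‖z' ε - c' ε‖ ≤ ρ ε ^ m := by
    intro ε
    by_cases h : ∃ x, B (σ ε) ε x
    · exact (hz'_spec ε h).1
    · simpa only [hz'_def, dif_neg h, sub_self, norm_zero] using pow_nonneg (ρ.pos ε).le m
  obtain ⟨z, hzU, hz⟩ := hm z' (Eventually.of_forall hz')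
  obtain ⟨a, ha⟩ := hf z hzU
  obtain ⟨a', ha'⟩ := exists_isRep a
  obtain ⟨N, hN⟩ := ha'.1
  obtain ⟨δ, hδ, hδ'⟩ := ha (q + 1)
  obtain ⟨δ', hδr⟩ := exists_isRep δ
  obtain ⟨K, hK⟩ := exists_eventually_add_le_of_lt isRep_zero hδr hδ
  set p := max N (K + 1)
  -- the points that are bad for the derivative `a`, at the indices with label `p`
  set C : I → ℂ → Prop := fun ε u => ‖u - c' ε‖ ≤ ρ ε ^ m ∧ ρ ε ^ k p ≤ ‖u - z' ε‖ ∧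
      ‖u - z' ε‖ ≤ ρ ε ^ p ∧ ρ ε ^ q * ‖u - z' ε‖ < ‖F ε u - F ε (z' ε) - a' ε * (u - z' ε)‖ with hC
  set u' : I → ℂ := fun ε => if h : ∃ u, C ε u then h.choose else z' ε with hu'_def
  have hu'_spec : ∀ ε, (∃ u, C ε u) → C ε (u' ε) := by
    intro ε h
    simp only [hu'_def, dif_pos h]
    exact h.choose_spec
  have hu' : ∀ ε, ‖u' ε - c' ε‖ ≤ ρ ε ^ m ∧ ‖u' ε - z' ε‖ ≤ ρ ε ^ p := by
    intro ε
    by_cases h : ∃ u, C ε u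
    · exact ⟨(hu'_spec ε h).1, (hu'_spec ε h).2.2.1⟩
    · refine ⟨?_, ?_⟩
      · simpa only [hu'_def, dif_neg h] using hz' ε
      · simpa only [hu'_def, dif_neg h, sub_self, norm_zero] using pow_nonneg (ρ.pos ε).le p
  obtain ⟨u, huU, hu⟩ := hm u' (Eventually.of_forall fun ε => (hu' ε).1)
  have hball : u ∈ ball z δ := by
    refine lt_of_eventually_add_le (hu.sub hz).abs hδr (k := K + 1) ?_
    filter_upwards [hK, ρ.eventually_two_mul_pow K] with ε h3 h5
    rw [Pi.zero_apply, zero_add] at h3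
    have h6 := (hu' ε).2.trans
      (pow_le_pow_of_le_one (ρ.pos ε).le (ρ.le_one ε) (le_max_right N (K + 1)))
    rw [Pi.sub_apply]
    linarith
  have hest := eventually_le_add_of_le
    (((hF u huU u' hu).sub (hF z hzU z' hz)).sub (ha'.mul (hu.sub hz))).abs
    ((isRep_dρ_pow (q + 1)).mul (hu.sub hz).abs) (hδ' u ⟨huU, hball⟩) (q + 1 + k p)
  obtain ⟨ε, ⟨h1, h2⟩, h3, h4, h5⟩ :=
    ((hσ' p).and_eventually (hest.and (hN.and (ρ.eventually_two_mul_pow q)))).exists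
  rw [← h1] at h2
  have h6 := hz'_spec ε h2
  rw [h1] at h6
  have h7 : ∃ u, C ε u := h6.2 (a' ε) (h4.trans
    (pow_le_pow_right₀ (ρ.one_le_inv ε) (le_max_left N (K + 1))))
  obtain ⟨-, h8, -, h9⟩ := hu'_spec ε h7
  simp only [Pi.sub_apply, Pi.mul_apply] at h3
  have h10 : ρ ε ^ (q + 1 + k p) ≤ ρ ε ^ (q + 1) * ‖u' ε - z' ε‖ := by
    rw [pow_add]
    exact mul_le_mul_of_nonneg_left h8 (pow_nonneg (ρ.pos ε).le _)
  have h11 := mul_le_mul_of_nonneg_right h5 (norm_nonneg (u' ε - z' ε))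
  linarith

end Uniform

/-! ### Approximation by a net of polynomials -/

section Approximation

variable {ρ : Gauge}

/-- Uniform approximate differentiability on the disc of radius `ρ^m` yields one net of polynomials
that approximates `F` up to negligible errors. For each accuracy `ρ^q` the discrete Cauchy formula
gives a polynomial, with a number of nodes that depends on `q`; one net is then selected. -/
theorem exists_polynomial_net {F : I → ℂ → ℂ} {c' : I → ℂ} {m N : ℕ}
    (hN : ∀ᶠ ε in atBot, ∀ x, ‖x - c' ε‖ ≤ ρ ε ^ m → ‖F ε x‖ ≤ (ρ ε)⁻¹ ^ N)
    (hF : ∀ q : ℕ, ∃ p : ℕ, ∀ k : ℕ, ∀ᶠ ε in atBot, ∀ x, ‖x - c' ε‖ ≤ ρ ε ^ m →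
      ∃ a : ℂ, ‖a‖ ≤ (ρ ε)⁻¹ ^ p ∧ ∀ u, ‖u - c' ε‖ ≤ ρ ε ^ m →
        ρ ε ^ k ≤ ‖u - x‖ → ‖u - x‖ ≤ ρ ε ^ p →
        ‖F ε u - F ε x - a * (u - x)‖ ≤ ρ ε ^ q * ‖u - x‖) :
    ∃ P : I → Polynomial ℂ,
      (∀ᶠ ε in atBot, ∀ j, ‖(P ε).coeff j‖ ≤ (ρ ε)⁻¹ ^ (j * m + N)) ∧
      ∀ q : ℕ, ∀ᶠ ε in atBot, ∀ x, ‖x - c' ε‖ ≤ ρ ε ^ m / 2 →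
        ‖F ε x - (P ε).eval (x - c' ε)‖ ≤ ρ ε ^ q := by
  have key : ∃ P : I → Polynomial ℂ, ∀ q : ℕ, ∀ᶠ ε in atBot,
      (∀ j, ‖(P ε).coeff j‖ ≤ (ρ ε)⁻¹ ^ (j * m + N)) ∧
      ∀ x, ‖x - c' ε‖ ≤ ρ ε ^ m / 2 → ‖F ε x - (P ε).eval (x - c' ε)‖ ≤ ρ ε ^ q := by
    refine exists_net_forall_eventually (P := fun q ε (P : Polynomial ℂ) =>
      (∀ j, ‖P.coeff j‖ ≤ (ρ ε)⁻¹ ^ (j * m + N)) ∧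
      ∀ x, ‖x - c' ε‖ ≤ ρ ε ^ m / 2 → ‖F ε x - P.eval (x - c' ε)‖ ≤ ρ ε ^ q) ?_ ?_
    · intro p q ε P hpq h
      exact ⟨h.1, fun x hx =>
        (h.2 x hx).trans (pow_le_pow_of_le_one (ρ.pos ε).le (ρ.le_one ε) hpq)⟩
    intro q
    obtain ⟨p, hp⟩ := hF (q + 1)
    filter_upwards [hN, hp (m + (q + p + 2) * 2), ρ.eventually_two_mul_le,
      ρ.eventually_mul_pow_succ_le 11 q, ρ.eventually_mul_pow_succ_le (2 * Real.pi) p]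
      with ε h1 h2 h3 h4 h5
    set r := ρ ε with hr_def
    have hr : 0 < r := ρ.pos ε
    have hr1 : r ≤ 1 := ρ.le_one ε
    have hinv : 2 ≤ r⁻¹ := by rw [inv_eq_one_div, le_div_iff₀ hr]; linarith
    have hrm : 0 < r ^ m := pow_pos hr m
    have hrm1 : r ^ m ≤ 1 := pow_le_one₀ hr.le hr1
    have hrmC : (r : ℂ) ^ m ≠ 0 := pow_ne_zero _ (Complex.ofReal_ne_zero.2 hr.ne')
    have hnorm : ∀ y : ℂ, ‖(r : ℂ) ^ m * y‖ = r ^ m * ‖y‖ := by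
      intro y
      rw [norm_mul, norm_pow, Complex.norm_real, Real.norm_eq_abs, abs_of_pos hr]
    set T := r⁻¹ ^ (q + p + 1) with hT_def
    have hT : 2 ≤ T := hinv.trans (le_self_pow₀ (by linarith) (by omega))
    -- `n` nodes make the largest scale `2π/n` at most `ρ^p` and the final error at most `11 ρ^(q+1)`
    set n := ⌈T⌉₊
    have hTn : T ≤ n := Nat.le_ceil T
    have hn2 : 2 ≤ n := by exact_mod_cast hT.trans hTn
    have hnT : (n : ℝ) ≤ r⁻¹ ^ (q + p + 2) := by
      have h6 : (n : ℝ) < T + 1 := Nat.ceil_lt_add_one (by linarith)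
      have h7 : T * 2 ≤ T * r⁻¹ := mul_le_mul_of_nonneg_left hinv (by linarith)
      rw [show q + p + 2 = q + p + 1 + 1 by ring, pow_succ]
      linarith
    have hn0 : (0 : ℝ) < n := by linarith
    have hinvT : T⁻¹ = r ^ (q + p + 1) := by rw [hT_def, inv_pow, inv_inv]
    have hinvn : (n : ℝ)⁻¹ ≤ r ^ (q + p + 1) := hinvT ▸ inv_anti₀ (by linarith) hTn
    have hmem : ∀ y : ℂ, ‖y‖ ≤ 1 → ‖c' ε + (r : ℂ) ^ m * y - c' ε‖ ≤ r ^ m := by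
      intro y hy
      rw [add_sub_cancel_left, hnorm]
      exact mul_le_of_le_one_right hrm.le hy
    obtain ⟨P, hP1, hP2⟩ := exists_polynomial_norm_sub_eval_le
      (Φ := fun y => F ε (c' ε + (r : ℂ) ^ m * y)) (A := r⁻¹ ^ N) (L := r⁻¹ ^ p)
      (η := r ^ (q + 1)) (h := r ^ ((q + p + 2) * 2)) (H := r ^ p) hn2 (by positivity)
      (fun y hy => h1 _ (hmem y hy))
      (by
        intro y hy
        obtain ⟨a, ha1, ha2⟩ := h2 _ (hmem y hy)
        refine ⟨(r : ℂ) ^ m * a, ?_, fun u hu hl hu' => ?_⟩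
        · rw [hnorm]
          exact (mul_le_of_le_one_left (norm_nonneg _) hrm1).trans ha1
        · have h6 : c' ε + (r : ℂ) ^ m * u - (c' ε + (r : ℂ) ^ m * y) = (r : ℂ) ^ m * (u - y) := by
            ring
          have h7 := ha2 _ (hmem u hu)
          rw [h6, hnorm] at h7
          have h8 := h7 (by rw [pow_add]; gcongr)
            ((mul_le_of_le_one_left (norm_nonneg _) hrm1).trans hu')
          rw [show a * ((r : ℂ) ^ m * (u - y)) = (r : ℂ) ^ m * a * (u - y) by ring] at h8
          refine h8.trans ?_
          gcongr
          exact mul_le_of_le_one_left (norm_nonneg _) hrm1)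
      (by
        rw [div_eq_mul_inv]
        calc 2 * Real.pi * (n : ℝ)⁻¹ ≤ 2 * Real.pi * r ^ (p + 1) := by
              gcongr
              exact hinvn.trans (pow_le_pow_of_le_one hr.le hr1 (by omega))
          _ ≤ r ^ p := h5)
      (by
        rw [pow_mul, one_div, ← inv_pow]
        gcongr
        rw [le_inv_comm₀ (by positivity) hn0, ← inv_pow]
        exact hnT)
    refine ⟨P.comp (Polynomial.C ((r : ℂ) ^ m)⁻¹ * Polynomial.X), fun j => ?_, fun x hx => ?_⟩
    · rw [Polynomial.comp_C_mul_X_coeff, norm_mul, norm_pow, norm_inv, norm_pow, Complex.norm_real,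
        Real.norm_eq_abs, abs_of_pos hr, pow_add, mul_comm j m, pow_mul, inv_pow, mul_comm]
      gcongr
      · simp
      · exact hP1 j
    · have h6 : ‖((r : ℂ) ^ m)⁻¹ * (x - c' ε)‖ ≤ 1 / 2 := by
        rw [norm_mul, norm_inv, norm_pow, Complex.norm_real, Real.norm_eq_abs, abs_of_pos hr,
          inv_mul_le_iff₀ hrm]
        linarith
      have h7 := hP2 _ h6
      rw [mul_inv_cancel_left₀ hrmC, add_sub_cancel] at h7
      simp only [Polynomial.eval_comp, Polynomial.eval_mul, Polynomial.eval_C, Polynomial.eval_X]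
      refine h7.trans (le_trans ?_ h4)
      have h8 : r ^ (q + 1) ≤ r⁻¹ ^ p := (pow_le_one₀ hr.le hr1).trans
        (one_le_pow₀ (by linarith))
      have h9 : r⁻¹ ^ p * r ^ (q + p + 1) = r ^ (q + 1) := by
        rw [show q + p + 1 = p + (q + 1) by ring, pow_add, ← mul_assoc, ← mul_pow,
          inv_mul_cancel₀ hr.ne', one_pow, one_mul]
      calc 5 * r ^ (q + 1) + 3 * (r⁻¹ ^ p + r ^ (q + 1)) / n
          ≤ 5 * r ^ (q + 1) + 3 * (r⁻¹ ^ p + r⁻¹ ^ p) * r ^ (q + p + 1) := by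
            rw [div_eq_mul_inv]; gcongr
        _ = 5 * r ^ (q + 1) + 6 * (r⁻¹ ^ p * r ^ (q + p + 1)) := by ring
        _ = 11 * r ^ (q + 1) := by rw [h9]; ring
  obtain ⟨P, hP⟩ := key
  exact ⟨P, (hP 0).mono fun ε h => h.1, fun q => (hP q).mono fun ε h => h.2⟩

end Approximation

/-! ### Hyperseries with geometrically decreasing terms -/

section Geometric

variable {ρ : Gauge}

theorem norm_mul_pow_le_geometric {r C : ℝ} {a x : ℂ} {m n : ℕ} (hr : 0 < r) (hr2 : 2 * r ≤ 1)
    (ha : ‖a‖ ≤ C * r⁻¹ ^ (n * m)) (hx : ‖x‖ ≤ r ^ (m + 1)) :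
    ‖a * x ^ n‖ ≤ C * (1 / 2) ^ n := by
  have hC : 0 ≤ C := nonneg_of_mul_nonneg_left ((norm_nonneg a).trans ha) (by positivity)
  rw [norm_mul, norm_pow]
  calc ‖a‖ * ‖x‖ ^ n ≤ C * r⁻¹ ^ (n * m) * (r ^ (m + 1)) ^ n :=
        mul_le_mul ha (pow_le_pow_left₀ (norm_nonneg _) hx n) (by positivity) (by positivity)
    _ = C * r ^ n * (r⁻¹ ^ (n * m) * r ^ (n * m)) := by
        rw [← pow_mul, add_mul, pow_add, one_mul, mul_comm m n]; ring
    _ = C * r ^ n := by rw [← mul_pow, inv_mul_cancel₀ hr.ne', one_pow, mul_one]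
    _ ≤ C * (1 / 2) ^ n := by gcongr; linarith

theorem exists_hyperN_isRep_ceil (K : ℕ) :
    ∃ M : hyperN ρ, IsRep ρ (fun ε => ((⌈(ρ ε)⁻¹ ^ K⌉₊ : ℕ) : ℝ)) M.1 := by
  have h : IsModerate ρ (fun ε => ((⌈(ρ ε)⁻¹ ^ K⌉₊ : ℕ) : ℝ)) := by
    refine isModerate_of_eventually_le (C := 2) (N := K) (Eventually.of_forall fun ε => ?_)
    have h1 : 1 ≤ (ρ ε)⁻¹ ^ K := one_le_pow₀ (ρ.one_le_inv ε)
    have h2 := (Nat.ceil_lt_add_one (by linarith : 0 ≤ (ρ ε)⁻¹ ^ K)).le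
    rw [Real.norm_natCast]
    linarith
  exact ⟨⟨mk ρ _ h, _, h, rfl⟩, h, rfl⟩

/-- Under a bound `ρ^{-nm-N}` on the coefficients and for `|z - c| ≤ ρ^{m+1}` the terms are at most
`ρ^{-N} 2^{-n}`, so that the hyperseries has the same sum as the series at each `ε`. -/
theorem hasHPSSum_of_norm_le {a : ℕ → I → ℂ} {z c s' : I → ℂ} {s : RC ρ ℂ} {m N : ℕ}
    (ha : ∀ᶠ ε in atBot, ∀ n, ‖a n ε‖ ≤ (ρ ε)⁻¹ ^ (n * m + N))
    (hz : ∀ᶠ ε in atBot, ‖z ε - c ε‖ ≤ ρ ε ^ (m + 1)) (hs : IsRep ρ s' s)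
    (hs' : ∀ q : ℕ, ∀ᶠ ε in atBot, ‖∑' n, a n ε * (z ε - c ε) ^ n - s' ε‖ ≤ ρ ε ^ q) :
    HasHPSSum a z c s := by
  have hterm : ∀ᶠ ε in atBot, ∀ n, ‖a n ε * (z ε - c ε) ^ n‖ ≤ (ρ ε)⁻¹ ^ N * (1 / 2) ^ n := by
    filter_upwards [ha, hz, ρ.eventually_two_mul_le] with ε h1 h2 h3 n
    refine norm_mul_pow_le_geometric (ρ.pos ε) h3 ?_ h2
    rw [mul_comm, ← pow_add]
    exact h1 n
  have hmod : IsModerateOverHypersums ρ (fun n ε => a n ε * (z ε - c ε) ^ n) := by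
    intro M
    refine isModerate_of_eventually_le (C := 2) (N := N) ?_
    filter_upwards [hterm] with ε h1
    refine (norm_sum_le_of_le _ fun n _ => h1 n).trans ?_
    rw [← Finset.mul_sum, mul_comm]
    exact mul_le_mul_of_nonneg_right (sum_geometric_two_le _)
      (pow_nonneg (inv_nonneg.2 (ρ.pos ε).le) _)
  refine ⟨hmod, fun q => ?_⟩
  -- the tail after `n` terms is at most `2^{-n} ≤ 1/n`, up to moderate factors, so a power of
  -- `1/ρ` serves as the bound `M`
  obtain ⟨M, hM⟩ := exists_hyperN_isRep_ceil (ρ := ρ) (N + (q + 3))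
  refine ⟨M, fun n hn => ?_⟩
  have hS : IsRep ρ (fun ε => ∑ k ∈ Finset.range (ni n ε + 1), a k ε * (z ε - c ε) ^ k)
      (mk ρ _ (hmod n)) := ⟨_, rfl⟩
  change (mk ρ _ (hmod n) - s).abs < _
  refine lt_of_eventually_add_le (hS.sub hs).abs (isRep_dρ_pow q) (k := q + 1) ?_
  filter_upwards [hterm, eventually_le_add_of_le hM (isRep_ni n) hn 0, hs' (q + 2),
    ρ.eventually_two_mul_pow q, ρ.eventually_two_mul_pow (q + 1),
    ρ.eventually_two_mul_pow (q + 2)] with ε h1 h2 h3 h4 h5 h6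
  have hr := ρ.pos ε
  have h7 : (ρ ε)⁻¹ ^ (N + (q + 3)) ≤ (ni n ε : ℝ) + 1 := (Nat.le_ceil _).trans (by simpa using h2)
  have hsum : Summable fun k => a k ε * (z ε - c ε) ^ k :=
    Summable.of_norm_bounded (summable_geometric_two.mul_left _) h1
  have h8 := norm_sub_le_of_geometric_bound_of_hasSum (by norm_num) h1 hsum.hasSum (ni n ε + 1)
  have h9 : (1 / 2 : ℝ) ^ (ni n ε + 1) ≤ ρ ε ^ (N + (q + 3)) := by
    rw [one_div, inv_pow, inv_le_comm₀ (by positivity) (by positivity), ← inv_pow]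
    refine h7.trans ?_
    exact_mod_cast Nat.lt_two_pow_self.le
  have h10 : (ρ ε)⁻¹ ^ N * (1 / 2) ^ (ni n ε + 1) / (1 - 1 / 2) ≤ 2 * ρ ε ^ (q + 3) := by
    calc (ρ ε)⁻¹ ^ N * (1 / 2) ^ (ni n ε + 1) / (1 - 1 / 2)
        = 2 * ((ρ ε)⁻¹ ^ N * (1 / 2) ^ (ni n ε + 1)) := by ring
      _ ≤ 2 * ((ρ ε)⁻¹ ^ N * ρ ε ^ (N + (q + 3))) := by gcongr
      _ = 2 * ρ ε ^ (q + 3) := by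
          rw [pow_add, ← mul_assoc ((ρ ε)⁻¹ ^ N), ← mul_pow, inv_mul_cancel₀ hr.ne', one_pow,
            one_mul]
  have h11 := norm_sub_le_norm_sub_add_norm_sub
    (∑ k ∈ Finset.range (ni n ε + 1), a k ε * (z ε - c ε) ^ k)
    (∑' k, a k ε * (z ε - c ε) ^ k) (s' ε)
  rw [Pi.sub_apply]
  linarith

end Geometric

/-! ### Generalized holomorphic functions are analytic -/

section Analytic

variable {ρ : Gauge}

theorem tsum_coeff_mul_pow (P : Polynomial ℂ) (x : ℂ) :
    ∑' n : ℕ, P.coeff n * x ^ n = P.eval x := by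
  rw [Polynomial.eval_eq_sum_range]
  refine tsum_eq_sum fun n hn => ?_
  rw [Polynomial.coeff_eq_zero_of_natDegree_lt (by simpa using hn), zero_mul]

/-- The power series at each `ε` is a polynomial, so its radius of convergence is `+∞`. -/
theorem toExt_lt_radius_polynomial (x : RC ρ ℝ) (P : I → Polynomial ℂ) :
    x.toExt < radius ρ (fun n ε => (P ε).coeff n) := by
  obtain ⟨y, hy⟩ := Quotient.exists_rep x.toExt
  refine ⟨y, fun _ => ⊤, hy, ?_, 0, Eventually.of_forall fun ε => le_top⟩
  rw [radius]
  congr 1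
  funext ε
  have h : limsup (fun n : ℕ => ENNReal.ofReal (‖(P ε).coeff n‖ ^ (1 / (n : ℝ)))) atTop = 0 := by
    rw [limsup_congr (v := fun _ => 0), limsup_const]
    filter_upwards [eventually_gt_atTop (P ε).natDegree] with n hn
    have hn0 : (1 / (n : ℝ)) ≠ 0 := by
      have : n ≠ 0 := by omega
      simpa using this
    rw [Polynomial.coeff_eq_zero_of_natDegree_lt hn, norm_zero, Real.zero_rpow hn0,
      ENNReal.ofReal_zero]
  rw [h, ENNReal.inv_zero, EReal.coe_ennreal_top]

/-- Cauchy's estimate: on the smaller disc the derivatives of the approximating polynomials are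
moderate, since the polynomials are bounded by moderate numbers. -/
theorem isModerate_deriv_eval {P : I → Polynomial ℂ} {w c : I → ℂ} {m N : ℕ}
    (hP : ∀ᶠ ε in atBot, ∀ x, ‖x - c ε‖ ≤ ρ ε ^ m / 2 →
      ‖(P ε).eval (x - c ε)‖ ≤ 2 * (ρ ε)⁻¹ ^ N)
    (hw : ∀ᶠ ε in atBot, ‖w ε - c ε‖ ≤ ρ ε ^ (m + 1)) :
    IsModerate ρ (fun ε => deriv (fun ζ : ℂ => (P ε).eval (ζ - c ε)) (w ε)) := by
  refine isModerate_of_eventually_le (C := 8) (N := N + m) ?_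
  filter_upwards [hP, hw, ρ.eventually_mul_pow_succ_le 4 m] with ε h1 h2 h3
  have hr := pow_pos (ρ.pos ε) m
  have hd : Differentiable ℂ fun ζ : ℂ => (P ε).eval (ζ - c ε) :=
    (P ε).differentiable.comp (differentiable_id.sub_const _)
  refine (Complex.norm_deriv_le_of_forall_mem_sphere_norm_le (R := ρ ε ^ m / 4) (by positivity)
    hd.diffContOnCl fun ζ hζ => h1 ζ ?_).trans (le_of_eq ?_)
  · have h4 := norm_sub_le_norm_sub_add_norm_sub ζ (w ε) (c ε)
    rw [mem_sphere_iff_norm] at hζ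
    linarith
  · rw [pow_add, inv_pow, inv_pow]
    field_simp
    norm_num

/-- The coefficients are those of the approximating polynomials. Other representatives of the
coefficients change the sum of the series by negligible amounts only, because their differences from
the given ones are below any power of `ρ`, uniformly in `n`. -/
theorem IsGHF.isGCAF {U : Set (RC ρ ℂ)} (hU : IsSharplyOpen U) {f : RC ρ ℂ → RC ρ ℂ}
    (hf : IsGHF U f) : IsGCAF U f := by
  intro c hc
  obtain ⟨⟨F, hF⟩, hf⟩ := hf
  obtain ⟨c₀, hc₀⟩ := exists_isRep c
  obtain ⟨m, hm⟩ := exists_pow_disc_subset hU hc hc₀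
  obtain ⟨N, hN⟩ := exists_uniform_bound hF hm
  obtain ⟨P, hP, hFP⟩ := exists_polynomial_net hN (exists_uniform_approx_deriv hF hf hm)
  have hPw : IsWeaklyModerate ρ (fun n ε => (P ε).coeff n) := ⟨m, N, hP⟩
  have hball : ∀ z ∈ ball c (dρ ρ ^ (m + 1)), ∀ z' c' : I → ℂ, IsRep ρ z' z → IsRep ρ c' c →
      ∀ᶠ ε in atBot, ‖z' ε - c' ε‖ ≤ ρ ε ^ (m + 1) := by
    intro z hz z' c' hz' hc'
    obtain ⟨k, hk⟩ := exists_eventually_add_le_of_lt (hz'.sub hc').abs (isRep_dρ_pow (m + 1)) hz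
    filter_upwards [hk] with ε h
    exact (le_add_of_nonneg_right (pow_nonneg (ρ.pos ε).le k)).trans h
  have hballU : ball c (dρ ρ ^ (m + 1)) ⊆ U := by
    intro z hz
    obtain ⟨z', hz'⟩ := exists_isRep z
    obtain ⟨y, hyU, hy⟩ := hm z' (by
      filter_upwards [hball z hz z' c₀ hz' hc₀] with ε h
      exact h.trans (pow_le_pow_of_le_one (ρ.pos ε).le (ρ.le_one ε) (Nat.le_succ m)))
    obtain ⟨h1, h2⟩ := hy
    obtain ⟨h3, h4⟩ := hz'
    rwa [← h4, h2]
  -- the increments `z' - c'` are transported to the fixed representative `c₀` of the centre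
  have heval : ∀ z ∈ ball c (dρ ρ ^ (m + 1)), ∀ z' c' : I → ℂ, IsRep ρ z' z → IsRep ρ c' c →
      IsRep ρ (fun ε => (P ε).eval (z' ε - c' ε)) (f z) := by
    intro z hz z' c' hz' hc'
    have h1 : IsRep ρ (c₀ + (z' - c')) z := by
      have := hc₀.add (hz'.sub hc')
      rwa [add_sub_cancel] at this
    refine (hF z (hballU hz) _ h1).of_sub_negligible fun q => ?_
    filter_upwards [hFP q, hball z hz z' c' hz' hc', ρ.eventually_mul_pow_succ_le 2 m]
      with ε h2 h3 h4
    have h5 := h2 (c₀ ε + (z' ε - c' ε)) (by rw [add_sub_cancel_left]; linarith)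
    rw [add_sub_cancel_left, norm_sub_rev] at h5
    exact h5
  have hEq : ∀ z ∈ ball c (dρ ρ ^ (m + 1)),
      EqHPS (f z) (⟦⟨fun n ε => (P ε).coeff n, hPw⟩⟧ : Coeff ρ) z c := by
    rintro z hz a' z' c' ⟨ha'w, ha'⟩ hz' hc'
    have hrel : ∀ q r : ℕ, ∀ᶠ ε in atBot, ∀ n : ℕ,
        ‖a' n ε - (P ε).coeff n‖ ≤ ρ ε ^ (n * q + r) := Quotient.exact ha'
    have hzc := hball z hz z' c' hz' hc'
    refine hasHPSSum_of_norm_le (m := m) (N := N + 1) ?_ hzc (heval z hz z' c' hz' hc') ?_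
    · filter_upwards [hrel 0 0, hP, ρ.eventually_two_mul_le] with ε h1 h2 h3 n
      have h4 : ‖a' n ε - (P ε).coeff n‖ ≤ 1 := by simpa using h1 n
      have h5 := norm_add_le (a' n ε - (P ε).coeff n) ((P ε).coeff n)
      rw [sub_add_cancel] at h5
      have h6 : 2 ≤ (ρ ε)⁻¹ := by
        rw [inv_eq_one_div, le_div_iff₀ (ρ.pos ε)]; exact h3
      have h7 : 1 ≤ (ρ ε)⁻¹ ^ (n * m + N) := one_le_pow₀ (ρ.one_le_inv ε)
      have h8 := mul_le_mul_of_nonneg_left h6 (by linarith : 0 ≤ (ρ ε)⁻¹ ^ (n * m + N))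
      rw [← add_assoc, pow_succ]
      linarith [h2 n]
    · intro q
      filter_upwards [hrel 0 (q + 1), hP, hzc, ρ.eventually_two_mul_le,
        ρ.eventually_mul_pow_succ_le 2 q] with ε h1 h2 h3 h4 h5
      have hr := ρ.pos ε
      have h6 : ∀ n, ‖(a' n ε - (P ε).coeff n) * (z' ε - c' ε) ^ n‖
          ≤ ρ ε ^ (q + 1) * (1 / 2) ^ n := fun n =>
        norm_mul_pow_le_geometric hr h4 ((by simpa using h1 n : _ ≤ ρ ε ^ (q + 1)).trans
          (le_mul_of_one_le_right (pow_nonneg hr.le _) (one_le_pow₀ (ρ.one_le_inv ε)))) h3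
      have h7 : ∀ n, ‖(P ε).coeff n * (z' ε - c' ε) ^ n‖ ≤ (ρ ε)⁻¹ ^ N * (1 / 2) ^ n := fun n =>
        norm_mul_pow_le_geometric hr h4 (by rw [mul_comm, ← pow_add]; exact h2 n) h3
      have hs1 := Summable.of_norm_bounded (summable_geometric_two.mul_left _) h6
      have hs2 := Summable.of_norm_bounded (summable_geometric_two.mul_left _) h7
      have h8 : ∑' n, a' n ε * (z' ε - c' ε) ^ n - (P ε).eval (z' ε - c' ε)
          = ∑' n, (a' n ε - (P ε).coeff n) * (z' ε - c' ε) ^ n := by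
        rw [← tsum_coeff_mul_pow, sub_eq_iff_eq_add, ← hs1.tsum_add hs2]
        congr 1
        funext n
        ring
      rw [h8]
      refine (tsum_of_norm_bounded (hasSum_geometric_two.mul_left _) h6).trans ?_
      linarith
  refine ⟨dρ ρ ^ (m + 1), ⟦⟨fun n ε => (P ε).coeff n, hPw⟩⟧, ?_, fun z hz => ⟨hballU hz, ?_⟩, hEq⟩
  · refine lt_of_eventually_add_le isRep_zero (isRep_dρ_pow (m + 1)) (k := m + 1)
      (Eventually.of_forall fun ε => ?_)
    simp
  · obtain ⟨z', hz'⟩ := exists_isRep z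
    refine ⟨fun n ε => (P ε).coeff n, z', c₀, ⟨hPw, rfl⟩, hz', hc₀,
      toExt_lt_radius_polynomial _ _, ⟨f z, ?_, hEq z hz _ _ _ ⟨hPw, rfl⟩ hz' hc₀⟩, fun w hw => ?_⟩
    · simp only [tsum_coeff_mul_pow]
      exact heval z hz z' c₀ hz' hc₀
    · simp only [tsum_coeff_mul_pow]
      refine isModerate_deriv_eval (m := m) (N := N) ?_ (hball z hz w c₀ hw hc₀)
      filter_upwards [hN, hFP 0] with ε h1 h2 x hx
      have h3 := h1 x (hx.trans (half_le_self (pow_nonneg (ρ.pos ε).le m)))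
      have h4 := h2 x hx
      have h5 := norm_sub_norm_le ((P ε).eval (x - c₀ ε)) (F ε x)
      rw [norm_sub_rev] at h5
      have h6 : 1 ≤ (ρ ε)⁻¹ ^ N := one_le_pow₀ (ρ.one_le_inv ε)
      rw [pow_zero] at h4
      linarith

end Analytic

end RobinsonColombeau

end

theorem mainTheorem1 (ρ : RobinsonColombeau.Gauge)
    (U : Set (RobinsonColombeau.RC ρ ℂ)) (hU : RobinsonColombeau.IsSharplyOpen U)
    (f : RobinsonColombeau.RC ρ ℂ → RobinsonColombeau.RC ρ ℂ)
    (hf : RobinsonColombeau.IsGHF U f) :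
    RobinsonColombeau.IsGCAF U f := by
  exact hf.isGCAF hU
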